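/- **Setting.** Let $d,k\ge 1$ be integers, $\alpha\in(0,\tfrac12]$, $\tau\in(0,1)$, $\mu\in\mathbb R^d$, $G\sim N(\mu,\mathbb I_d)$, and put $\gamma=\log\big(\tfrac{dk}{\alpha}\log\tfrac1\tau\big)$. All data sets are finite multisets of points of $\mathbb R^d$; cardinalities and intersections count multiplicity. *Sparse polynomials.* A $k^2$-sparse polynomial is either a linear form $p(x)=v\cdot x$, where $v\in\mathbb R^d$ has at most $k^2$ non-zero entries, or a degree-2 harmonic polynomial $p(x)=h_A(x)=\tfrac1{\sqrt2}\sum_{i_1,i_2}A_{i_1i_2}\prod_j\mathrm{He}_{c_j(i_1,i_2)}(x_j)$, where $A$ is a symmetric matrix with at most $k^2$ non-zero entries, $c_j(i_1,i_2)$ is the number of occurrences of $j$ among $i_1,i_2$, and $\mathrm{He}_a$ are the probabilists' Hermite polynomials (so $h_A(x)=\tfrac1{\sqrt2}(x^\top Ax-\operatorname{tr}A)$). *Representative sets.* A non-empty $S$ is representative if for every $k^2$-sparse polynomial $p$ $$\Big|\Pr[p(G)\ge0]-\Pr_{x\sim S}[p(x)\ge0]\Big|\le\frac{\alpha^3}{100\,k^4\gamma^2},$$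 where $x\sim S$ is uniform on $S$. *Good sets.* For a constant $R>0$, $T'$ is $\alpha$-good (with constant $R$) if there is a representative $S$ with $|S\cap T'|\ge\max\{(1-\alpha/6)|S|,\ \alpha|T'|\}$ and $\|x-y\|_\infty\le R\sqrt{\log(d|S|/\alpha)}$ for all $x,y\in T'$. *The algorithm* $\textsc{Cluster}$, with constant $C>0$, on input $T$: start with $\mathcal C=\emptyset$; go through the $x\in T$ one after the other, in any order, and add $x$ to $\mathcal C$ if at least $\alpha|T|$ samples $y\in T$ satisfy $\|x-y\|_\infty\le2C\sqrt\gamma$ and no $x'\in\mathcal C$ satisfies $\|x-x'\|_\infty\le4C\sqrt\gamma$. Return the list of the multisets $T_i=\{y\in T:\|x_i-y\|_\infty\le6C\sqrt\gamma\}$, one for each $x_i\in\mathcal C$. **Lemma (Initial List).** For every $c>0$ there are $C_0,K>0$ such that for every $C\ge C_0$ there is $R>0$ (the constants depend on nothing else) with the following property. Let $d,k,\alpha,\tau,\mu$ be as above with $\log\frac1\tau\ge c$ and $\gamma\ge c$ (for $c=\tfrac3{10}$ both hold whenever $\tau\le\frac12$). Let $T$ consist of $$n\ \ge\ K\,\alpha^{-7}k^{12}\,\log\Big(\frac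 d\tau\Big)\,\log^4\Big(\frac{dk}{\alpha}\log\frac1\tau\Big)$$ samples in $\mathbb R^d$, of which at least $2\alpha n$ (at fixed positions) are independent draws from $N(\mu,\mathbb I_d)$, while the others are arbitrary and may depend on these draws. Then $\textsc{Cluster}$ with constant $C$ always returns a list of at most $1/\alpha$ sub-multisets of $T$, and with probability at least $1-\tau$, in whatever order it goes through $T$, at least one of them is $\alpha$-good with constant $R$. -/

import Mathlib

open MeasureTheory ProbabilityTheory

namespace InitialList

/-- The Gaussian distribution `N(μ, I_d)` on `ℝ^d`.  The space `Fin d → ℝ` is used throughout, so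
that its norm is the `ℓ∞` norm. -/
noncomputable def gaussian {d : ℕ} (μ : Fin d → ℝ) : Measure (Fin d → ℝ) :=
  Measure.pi fun i => gaussianReal (μ i) 1

/-- The degree-`2` harmonic polynomial of a matrix `A`:
`√(2!) · h_A(x) = ∑_{i₁, i₂} A_{i₁ i₂} ∏_j He_{c_j(i₁, i₂)}(x_j)`, where `c_j(i₁, i₂)` is the number
of times that `j` occurs among `i₁, i₂` and `He` are the probabilists' Hermite polynomials. -/
noncomputable def harmonic {d : ℕ} (A : Matrix (Fin d) (Fin d) ℝ) (x : Fin d → ℝ) : ℝ :=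
  (Real.sqrt 2)⁻¹ * ∑ i₁, ∑ i₂, A i₁ i₂ *
    ∏ j, Polynomial.aeval (x j)
      (Polynomial.hermite ((if i₁ = j then 1 else 0) + (if i₂ = j then 1 else 0)))

/-- `k²`-sparse polynomials: linear forms with at most `k²` nonzero coefficients, and degree-`2`
harmonic polynomials of symmetric matrices with at most `k²` nonzero entries. -/
def IsSparsePoly {d : ℕ} (k : ℕ) (p : (Fin d → ℝ) → ℝ) : Prop :=
  (∃ v : Fin d → ℝ, {i | v i ≠ 0}.ncard ≤ k ^ 2 ∧ p = fun x => ∑ i, v i * x i) ∨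
  (∃ A : Matrix (Fin d) (Fin d) ℝ, A.IsSymm ∧
    {q : Fin d × Fin d | A q.1 q.2 ≠ 0}.ncard ≤ k ^ 2 ∧ p = harmonic A)

/-- `γ = log ((d k / α) · log (1 / τ))`. -/
noncomputable def gam (d k : ℕ) (α τ : ℝ) : ℝ :=
  Real.log (d * k / α * Real.log (1 / τ))

open Classical in
/-- The probability that `p(x) ≥ 0` when `x` is drawn uniformly from the multiset `S`. -/
noncomputable def empProb {d : ℕ} (p : (Fin d → ℝ) → ℝ) (S : Multiset (Fin d → ℝ)) : ℝ :=
  ((S.filter fun x => 0 ≤ p x).card : ℝ) / S.card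

/-- `S` is representative with respect to `G ∼ N(μ, I_d)`. -/
def IsRepresentative {d : ℕ} (k : ℕ) (α τ : ℝ) (μ : Fin d → ℝ)
    (S : Multiset (Fin d → ℝ)) : Prop :=
  S ≠ 0 ∧ ∀ p : (Fin d → ℝ) → ℝ, IsSparsePoly k p →
    |(gaussian μ).real {x | 0 ≤ p x} - empProb p S| ≤ α ^ 3 / (100 * k ^ 4 * gam d k α τ ^ 2)

open Classical in
/-- `T` is `α`-good with respect to `G ∼ N(μ, I_d)`; `R` is the constant hidden in the bound
`O(√(log (d |S| / α)))` on the `ℓ∞` diameter.  Intersections and cardinalities are those of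
multisets. -/
def IsGood {d : ℕ} (R : ℝ) (k : ℕ) (α τ : ℝ) (μ : Fin d → ℝ)
    (T : Multiset (Fin d → ℝ)) : Prop :=
  ∃ S : Multiset (Fin d → ℝ), IsRepresentative k α τ μ S ∧
    max ((1 - α / 6) * S.card) (α * T.card) ≤ ((S ∩ T).card : ℝ) ∧
    ∀ x ∈ T, ∀ y ∈ T, ‖x - y‖ ≤ R * Real.sqrt (Real.log (d * S.card / α))

open Classical in
/-- The centres selected by the clustering algorithm when it goes through the data set in the order
of the list `l`: a sample `x` becomes a centre if at least `α |T|` samples are within distance `2r`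
of it and no earlier centre is within distance `4r`, i.e. the closed ball of radius `2r` around `x`
is disjoint from those around the earlier centres. -/
noncomputable def clusterCenters {d : ℕ} (α r : ℝ) (l : List (Fin d → ℝ)) : List (Fin d → ℝ) :=
  l.foldl (fun 𝒞 x =>
    if α * l.length ≤ (((l : Multiset (Fin d → ℝ)).filter fun y => ‖x - y‖ ≤ 2 * r).card : ℝ) ∧
        ∀ x' ∈ 𝒞, ¬ ‖x - x'‖ ≤ 4 * r
    then 𝒞 ++ [x] else 𝒞) []

open Classical in
/-- The clustering algorithm with constant `C`, run on the data set `l` (in the order of the list):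
with `r = C √γ`, it returns the multisets `T ∩ {y : ‖x_i - y‖ ≤ 6r}` for the selected centres
`x_i`. -/
noncomputable def cluster {d : ℕ} (C : ℝ) (k : ℕ) (α τ : ℝ) (l : List (Fin d → ℝ)) :
    List (Multiset (Fin d → ℝ)) :=
  (clusterCenters α (C * Real.sqrt (gam d k α τ)) l).map fun c =>
    (l : Multiset (Fin d → ℝ)).filter fun y => ‖c - y‖ ≤ 6 * (C * Real.sqrt (gam d k α τ))

/-- The data set as a multiset: the values of the `n` samples `X i` at the outcome `ω`. -/
def dataset {Ω : Type*} {d n : ℕ} (X : Fin n → Ω → Fin d → ℝ) (ω : Ω) :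
    Multiset (Fin d → ℝ) :=
  Finset.univ.val.map fun i => X i ω

end InitialList

/-! Let `S` be the multiset of Gaussian samples and `r = C √γ`. Two properties of `S` suffice, so
the other samples and the order of the data play no role: `S` is representative, and all but a
fraction `α / 6` of `S` lies within `r` of `μ`. Each sample in that ball then has at least `α n`
samples within `2r`, hence some centre lies within `4r` of it, and the ball of radius `6r` around
this centre contains the whole part of `S` near `μ` (`exists_cluster_superset`). Balls of radius
`2r` around the centres are disjoint and each holds `α n` samples, which bounds the length of the
list.

A sparse polynomial is a linear form in `k²` features, and there are at most `2 d ^ (2 k²)` feature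
maps. A union bound reduces representativity to the uniform convergence of homogeneous halfspaces in
dimension `D = k²`. With `ε = α³ / (100 k⁴ γ²)`, the stated `n` leaves room for about `(D² + log (1
/ δ)) / ε²` Gaussian samples, without a further `log (1 / ε)`. That rate comes from chaining
(`card_signs_exists_pattern_le`): Sauer–Shelah yields a packing bound for sign patterns at every
scale, Hoeffding's inequality controls each link of the chain, and symmetrization with a ghost
sample (`measure_exists_halfspace_deviation_le`) passes from random signs to random samples. -/

namespace InitialList

open Finset
open scoped symmDiff

/-! ### VC dimension of homogeneous halfspaces -/

section Patterns

open Classical in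
/-- The sign patterns `{i | 0 ≤ a ⬝ᵥ z i}` that homogeneous halfspaces cut out of the points `z`. -/
noncomputable def patterns {κ : Type*} [Fintype κ] {D : ℕ} (z : κ → Fin D → ℝ) :
    Finset (Finset κ) :=
  univ.filter fun A => ∃ a : Fin D → ℝ, ∀ i, i ∈ A ↔ 0 ≤ a ⬝ᵥ z i

lemma mem_patterns {κ : Type*} [Fintype κ] {D : ℕ} {z : κ → Fin D → ℝ} {A : Finset κ} :
    A ∈ patterns z ↔ ∃ a : Fin D → ℝ, ∀ i, i ∈ A ↔ 0 ≤ a ⬝ᵥ z i := by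
  simp [patterns]

/-- Homogeneous halfspaces of `ℝ^D` shatter at most `D` points. -/
lemma card_le_of_shatters_patterns {κ : Type*} [Fintype κ] [DecidableEq κ] {D : ℕ}
    {z : κ → Fin D → ℝ} {s : Finset κ} (hs : (patterns z).Shatters s) : #s ≤ D := by
  by_contra! hlt
  have hdep : ¬ LinearIndependent ℝ fun i : s => z i := fun h => by
    have := h.fintype_card_le_finrank
    simp at this
    omega
  obtain ⟨g, hg, i₀, hi₀⟩ : ∃ g : s → ℝ, ∑ i, g i • z i = 0 ∧ ∃ i, g i < 0 := by
    obtain ⟨g, hg, i, hi⟩ := Fintype.not_linearIndependent_iff.1 hdep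
    rcases lt_or_gt_of_ne hi with h | h
    · exact ⟨g, hg, i, h⟩
    · exact ⟨-g, by simpa only [Pi.neg_apply, neg_smul, sum_neg_distrib, neg_eq_zero] using hg, i,
        by simpa using h⟩
  -- A halfspace cutting out exactly the points with nonnegative coefficient makes every term of `∑
  -- g i * (a ⬝ᵥ z i)` nonnegative and the term of `i₀` positive, while the dependence makes the sum
  -- zero. Since the halfspaces are closed, strictness needs a negative coefficient.
  obtain ⟨u, hu, hsu⟩ := hs (t := s.filter fun i => ∀ h : i ∈ s, 0 ≤ g ⟨i, h⟩) (filter_subset _ _)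
  obtain ⟨a, ha⟩ := mem_patterns.1 hu
  have key (i : s) : 0 ≤ g i ↔ 0 ≤ a ⬝ᵥ z i := by
    rw [← ha]
    have := Finset.ext_iff.1 hsu i
    simp only [mem_inter, i.2, true_and, mem_filter] at this
    rw [this]
    simp
  have hsum : ∑ i, g i * (a ⬝ᵥ z i) = 0 := by
    have := congrArg (fun v => a ⬝ᵥ v) hg
    simpa [dotProduct_sum, dotProduct_smul] using this
  have hpos : 0 < ∑ i, g i * (a ⬝ᵥ z i) := by
    refine sum_pos' (fun i _ => ?_) ⟨i₀, mem_univ _, ?_⟩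
    · by_cases h : 0 ≤ g i
      · exact mul_nonneg h ((key i).1 h)
      · exact mul_nonneg_of_nonpos_of_nonpos (not_le.1 h).le
          (not_le.1 (fun h' => h ((key i).2 h'))).le
    · exact mul_pos_of_neg_of_neg hi₀ (not_le.1 fun h' => (not_le.2 hi₀) ((key i₀).2 h'))
  exact hpos.ne' hsum

lemma sum_choose_le_pow (s D : ℕ) : ∑ i ∈ Iic D, s.choose i ≤ (s + 1) ^ D := by
  rw [add_pow, ← Nat.range_succ_eq_Iic]
  refine sum_le_sum fun i hi => ?_
  have hiD : i ≤ D := Nat.lt_succ_iff.1 (mem_range.1 hi)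
  have := Nat.choose_pos hiD
  calc s.choose i ≤ s ^ i := Nat.choose_le_pow s i
    _ ≤ s ^ i * 1 ^ (D - i) * D.choose i := by
      rw [one_pow, mul_one]; exact Nat.le_mul_of_pos_right _ this

/-- Sauer–Shelah, with VC dimension at most `D`. -/
lemma card_patterns_le {κ : Type*} [Fintype κ] {D : ℕ} (z : κ → Fin D → ℝ) :
    #(patterns z) ≤ (Fintype.card κ + 1) ^ D := by
  classical
  refine (card_le_card_shatterer _).trans <| card_shatterer_le_sum_vcDim.trans <|
    le_trans ?_ (sum_choose_le_pow _ D)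
  refine sum_le_sum_of_subset (Iic_subset_Iic.2 ?_)
  exact Finset.sup_le fun s hs => card_le_of_shatters_patterns (mem_shatterer.1 hs)

end Patterns

/-! ### Packing numbers of the sign patterns -/

section Packing

variable {ι : Type*} [Fintype ι] [DecidableEq ι]

/-- A separated family of sets is traced injectively on few, suitably chosen points. -/
lemma exists_injOn_preimage {ℬ : Finset (Finset ι)} {δ : ℝ} (hδ : δ ≤ 1)
    (hm : 0 < Fintype.card ι)
    (hsep : ∀ A ∈ ℬ, ∀ B ∈ ℬ, A ≠ B → δ * Fintype.card ι ≤ (#(A ∆ B) : ℝ)) {s : ℕ}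
    (hs : (#ℬ : ℝ) ^ 2 * (1 - δ) ^ s < 1) :
    ∃ g : Fin s → ι, Set.InjOn (fun A : Finset ι => univ.filter fun j => g j ∈ A) ℬ := by
  by_contra! hcon
  set m := Fintype.card ι
  -- Otherwise every `g` misses `A ∆ B` for some pair `A ≠ B`. Each pair accounts for at most `((1 -
  -- δ) m) ^ s` of the `m ^ s` tuples, too few by `hs`.
  have hcover : (univ : Finset (Fin s → ι)) ⊆
      (ℬ ×ˢ ℬ).biUnion fun q => if q.1 = q.2 then ∅ else Fintype.piFinset fun _ => (q.1 ∆ q.2)ᶜ := by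
    intro g _
    obtain ⟨A, hA, B, hB, hAB, hne⟩ : ∃ A ∈ ℬ, ∃ B ∈ ℬ,
        (univ.filter fun j => g j ∈ A) = (univ.filter fun j => g j ∈ B) ∧ A ≠ B := by
      simpa [Set.InjOn] using hcon g
    refine mem_biUnion.2 ⟨(A, B), by simp [hA, hB], ?_⟩
    simp only [hne, if_false, Fintype.mem_piFinset, mem_compl, mem_symmDiff]
    intro j
    have := Finset.ext_iff.1 hAB j
    simp only [mem_filter, mem_univ, true_and] at this
    tauto
  have hcard := (card_le_card hcover).trans card_biUnion_le
  have hcard' : ((m : ℝ)) ^ s ≤ ∑ q ∈ ℬ ×ˢ ℬ, ((1 - δ) * m) ^ s := by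
    have h1 : ((m : ℝ)) ^ s = ((#(univ : Finset (Fin s → ι)) : ℕ) : ℝ) := by simp [m]
    rw [h1]
    refine (Nat.cast_le.2 hcard).trans ?_
    rw [Nat.cast_sum]
    refine sum_le_sum fun q hq => ?_
    obtain ⟨hq1, hq2⟩ := mem_product.1 hq
    have hm0 : (0 : ℝ) ≤ (1 - δ) * m := mul_nonneg (by linarith) (Nat.cast_nonneg _)
    split_ifs with h
    · simpa using pow_nonneg hm0 s
    · rw [Fintype.card_piFinset, prod_const, card_univ, Fintype.card_fin, Nat.cast_pow]
      refine pow_le_pow_left₀ (Nat.cast_nonneg _) ?_ s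
      rw [card_compl, Nat.cast_sub (card_le_univ _)]
      have := hsep _ hq1 _ hq2 h
      linarith
  rw [sum_const, card_product, nsmul_eq_mul, mul_pow, Nat.cast_mul] at hcard'
  have hmpos : (0 : ℝ) < (m : ℝ) ^ s := by positivity
  nlinarith

/-- Logarithmic bound for the solutions of `M ≤ (s + 1) ^ D` with `s ≈ 2 δ⁻¹ log M`. -/
lemma log_le_of_le_pow {M δ : ℝ} {D : ℕ} (hM : 1 ≤ M) (hδ : 0 < δ) (hδ1 : δ ≤ 1) (hD : 1 ≤ D)
    (h : M ≤ (2 * Real.log M / δ + 2) ^ D) :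
    Real.log M ≤ 2 * D * Real.log (2 / δ) + 4 * D ^ 2 := by
  have hl : 0 ≤ Real.log M := Real.log_nonneg hM
  have hD' : (1 : ℝ) ≤ D := by exact_mod_cast hD
  have h1 : 2 * Real.log M / δ + 2 ≤ 2 / δ * (Real.log M + 1) := by
    have : 2 ≤ 2 / δ := by rw [le_div_iff₀ hδ]; linarith
    calc _ = 2 / δ * Real.log M + 2 := by ring
      _ ≤ _ := by linarith
  have h2 : Real.log M ≤ D * (Real.log (2 / δ) + Real.log (Real.log M + 1)) := by
    calc Real.log M ≤ Real.log ((2 / δ * (Real.log M + 1)) ^ D) :=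
          Real.log_le_log (by linarith) (h.trans (pow_le_pow_left₀ (by positivity) h1 D))
      _ = _ := by rw [Real.log_pow, Real.log_mul (by positivity) (by positivity)]
  -- Splitting off the factor `2 * D` before using `log t ≤ t - 1` leaves only half of `log M` on
  -- the right after multiplication by `D`.
  have h3 : Real.log (Real.log M + 1) ≤ (Real.log M + 1) / (2 * D) + 2 * D - 1 := by
    have e : Real.log M + 1 = (Real.log M + 1) / (2 * D) * (2 * D) := by field_simp
    have a1 := Real.log_le_sub_one_of_pos (show 0 < (Real.log M + 1) / (2 * D) by positivity)
    have a2 := Real.log_le_sub_one_of_pos (show (0 : ℝ) < 2 * D by positivity)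
    rw [e, Real.log_mul (by positivity) (by positivity), ← e]
    linarith
  have h4 : D * Real.log (Real.log M + 1) ≤ (Real.log M + 1) / 2 + 2 * D ^ 2 - D := by
    calc D * Real.log (Real.log M + 1) ≤ D * ((Real.log M + 1) / (2 * D) + 2 * D - 1) := by gcongr
      _ = _ := by field_simp
  nlinarith

/-- Packing bound for the sign patterns of halfspaces. -/
lemma log_card_le_of_separated {D : ℕ} (hD : 1 ≤ D) {z : ι → Fin D → ℝ} {ℬ : Finset (Finset ι)}
    (hℬ : ℬ ⊆ patterns z) (hm : 0 < Fintype.card ι) (hne : ℬ.Nonempty) {δ : ℝ} (hδ0 : 0 < δ)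
    (hδ : δ ≤ 1)
    (hsep : ∀ A ∈ ℬ, ∀ B ∈ ℬ, A ≠ B → δ * Fintype.card ι ≤ (#(A ∆ B) : ℝ)) :
    Real.log #ℬ ≤ 2 * D * Real.log (2 / δ) + 4 * D ^ 2 := by
  have hM : (1 : ℝ) ≤ #ℬ := by exact_mod_cast hne.card_pos
  have hl := Real.log_nonneg hM
  -- Just large enough for `#ℬ ^ 2 * exp (-δ s) < 1`. The traces on `s` points are then distinct
  -- patterns, so `#ℬ ≤ (s + 1) ^ D`.
  set s := ⌊2 * Real.log #ℬ / δ⌋₊ + 1 with hs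
  have hs1 : 2 * Real.log #ℬ / δ < s := by rw [hs]; push_cast; exact Nat.lt_floor_add_one _
  have hs2 : (s : ℝ) ≤ 2 * Real.log #ℬ / δ + 1 := by
    rw [hs]; push_cast; gcongr; exact Nat.floor_le (by positivity)
  obtain ⟨g, hg⟩ := exists_injOn_preimage (s := s) hδ hm hsep (by
    have h1 : (1 - δ) ^ s ≤ Real.exp (-(δ * s)) := by
      calc (1 - δ) ^ s ≤ Real.exp (-δ) ^ s :=
            pow_le_pow_left₀ (by linarith) (by linarith [Real.add_one_le_exp (-δ)]) s
        _ = _ := by rw [← Real.exp_nat_mul]; ring_nf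
    have h2 : (#ℬ : ℝ) ^ 2 = Real.exp (2 * Real.log #ℬ) := by
      rw [two_mul, Real.exp_add, Real.exp_log (by linarith), sq]
    calc (#ℬ : ℝ) ^ 2 * (1 - δ) ^ s ≤ Real.exp (2 * Real.log #ℬ) * Real.exp (-(δ * s)) := by
          rw [h2]; gcongr
      _ = Real.exp (2 * Real.log #ℬ - δ * s) := by rw [← Real.exp_add]; ring_nf
      _ < 1 := by
        rw [Real.exp_lt_one_iff]
        rw [div_lt_iff₀ hδ0] at hs1
        linarith)
  refine log_le_of_le_pow hM hδ0 hδ hD ?_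
  have hcard : #ℬ ≤ (s + 1) ^ D := by
    rw [← card_image_of_injOn hg]
    refine (card_le_card ?_).trans ((card_patterns_le (z ∘ g)).trans (by simp))
    intro B hB
    obtain ⟨A, hA, rfl⟩ := mem_image.1 hB
    obtain ⟨a, ha⟩ := mem_patterns.1 (hℬ hA)
    exact mem_patterns.2 ⟨a, fun j => by simp [ha]⟩
  calc (#ℬ : ℝ) ≤ ((s : ℝ) + 1) ^ D := by exact_mod_cast hcard
    _ ≤ _ := pow_le_pow_left₀ (by positivity) (by linarith) D

/-- Maximal separated subfamilies are nets. -/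
lemma exists_separated_net (𝒜 : Finset (Finset ι)) {θ : ℝ} (hθ : 0 < θ) :
    ∃ N ⊆ 𝒜, (∀ A ∈ N, ∀ B ∈ N, A ≠ B → θ ≤ (#(A ∆ B) : ℝ)) ∧
      ∀ A ∈ 𝒜, ∃ B ∈ N, (#(A ∆ B) : ℝ) < θ := by
  classical
  obtain ⟨N, hN, hmax⟩ := exists_max_image
    (𝒜.powerset.filter fun N => ∀ A ∈ N, ∀ B ∈ N, A ≠ B → θ ≤ (#(A ∆ B) : ℝ)) card
    ⟨∅, by simp⟩
  obtain ⟨hN1, hN2⟩ := mem_filter.1 hN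
  refine ⟨N, mem_powerset.1 hN1, hN2, fun A hA => ?_⟩
  by_contra! hcon
  have hAN : A ∉ N := fun h => by
    have := hcon A h
    simp at this
    linarith
  have := hmax (insert A N) (mem_filter.2 ⟨mem_powerset.2
    (insert_subset hA (mem_powerset.1 hN1)), ?_⟩)
  · rw [card_insert_of_notMem hAN] at this
    omega
  · intro P hP Q hQ hPQ
    rcases mem_insert.1 hP with hP' | hP' <;> rcases mem_insert.1 hQ with hQ' | hQ'
    · exact absurd (hP'.trans hQ'.symm) hPQ
    · exact hP' ▸ hcon Q hQ'
    · rw [symmDiff_comm]; exact hQ' ▸ hcon P hP'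
    · exact hN2 P hP' Q hQ' hPQ

end Packing

end InitialList

namespace InitialList

open Finset
open scoped symmDiff

/-! ### Chaining for Rademacher sums -/

section Chaining

variable {ι : Type*} [Fintype ι] [DecidableEq ι]

/-- The sign `±1` of a Boolean. -/
def sgn (b : Bool) : ℝ := if b then 1 else -1

/-- The sum factors over the coordinates into terms `2 cosh (t w i)`, and `cosh x ≤ exp (x² / 2)`.
-/
lemma sum_exp_signs_le (w : ι → ℝ) (t : ℝ) :
    ∑ σ : ι → Bool, Real.exp (t * ∑ i, w i * sgn (σ i)) ≤
      2 ^ Fintype.card ι * Real.exp (t ^ 2 * (∑ i, w i ^ 2) / 2) := by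
  have h1 : ∑ σ : ι → Bool, Real.exp (t * ∑ i, w i * sgn (σ i)) =
      ∏ i, ∑ b : Bool, Real.exp (t * (w i * sgn b)) := by
    rw [prod_univ_sum, Fintype.piFinset_univ]
    exact sum_congr rfl fun σ _ => by rw [mul_sum, Real.exp_sum]
  rw [h1]
  calc ∏ i, ∑ b : Bool, Real.exp (t * (w i * sgn b))
      ≤ ∏ i, 2 * Real.exp ((t * w i) ^ 2 / 2) := by
        refine prod_le_prod (fun i _ => by positivity) fun i _ => ?_
        have := Real.cosh_le_exp_half_sq (t * w i)
        rw [Real.cosh_eq] at this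
        simp only [Fintype.sum_bool, sgn, if_true, Bool.false_eq_true, if_false, mul_one,
          mul_neg]
        linarith
    _ = _ := by
        rw [prod_mul_distrib, prod_const, card_univ, ← Real.exp_sum, mul_sum, sum_div]
        congr 2
        exact sum_congr rfl fun i _ => by ring

lemma card_signs_gt_le (w : ι → ℝ) {s V : ℝ} (hs : 0 ≤ s) (hV : 0 < V)
    (hw : ∑ i, w i ^ 2 ≤ V) :
    (#{σ : ι → Bool | s < ∑ i, w i * sgn (σ i)} : ℝ) ≤
      2 ^ Fintype.card ι * Real.exp (-(s ^ 2 / (2 * V))) := by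
  -- Markov's inequality for the exponential with parameter `s / V`, the minimiser of `t² V / 2 - t
  -- s`.
  have h1 : (#{σ : ι → Bool | s < ∑ i, w i * sgn (σ i)} : ℝ) * Real.exp (s / V * s) ≤
      2 ^ Fintype.card ι * Real.exp ((s / V) ^ 2 * V / 2) := by
    calc _ = ∑ σ : ι → Bool with s < ∑ i, w i * sgn (σ i), Real.exp (s / V * s) := by
          rw [sum_const, nsmul_eq_mul]
      _ ≤ ∑ σ : ι → Bool with s < ∑ i, w i * sgn (σ i),
            Real.exp (s / V * ∑ i, w i * sgn (σ i)) := by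
          refine sum_le_sum fun σ hσ => Real.exp_le_exp.2 ?_
          exact mul_le_mul_of_nonneg_left (mem_filter.1 hσ).2.le (by positivity)
      _ ≤ ∑ σ : ι → Bool, Real.exp (s / V * ∑ i, w i * sgn (σ i)) :=
          sum_le_sum_of_subset_of_nonneg (filter_subset _ _) fun _ _ _ => (Real.exp_pos _).le
      _ ≤ _ := (sum_exp_signs_le w _).trans (by gcongr)
  rw [← le_div_iff₀ (Real.exp_pos _), mul_div_assoc, ← Real.exp_sub] at h1
  refine h1.trans_eq ?_
  congr 2
  field_simp
  ring

/-- Hoeffding's inequality for Rademacher sums, by counting signs. -/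
lemma card_signs_abs_gt_le (w : ι → ℝ) {s V : ℝ} (hs : 0 ≤ s) (hV : 0 < V)
    (hw : ∑ i, w i ^ 2 ≤ V) :
    (#{σ : ι → Bool | s < |∑ i, w i * sgn (σ i)|} : ℝ) ≤
      2 ^ Fintype.card ι * (2 * Real.exp (-(s ^ 2 / (2 * V)))) := by
  have h1 := card_signs_gt_le w hs hV hw
  have h2 := card_signs_gt_le (fun i => -w i) hs hV (by simpa using hw)
  have h3 : ({σ : ι → Bool | s < |∑ i, w i * sgn (σ i)|} : Finset _) ⊆
      univ.filter (fun σ : ι → Bool => s < ∑ i, w i * sgn (σ i)) ∪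
        univ.filter (fun σ : ι → Bool => s < ∑ i, -w i * sgn (σ i)) := by
    intro σ
    simp [lt_abs]
  have h4 : (#{σ : ι → Bool | s < |∑ i, w i * sgn (σ i)|} : ℝ) ≤
      #{σ : ι → Bool | s < ∑ i, w i * sgn (σ i)} +
        #{σ : ι → Bool | s < ∑ i, -w i * sgn (σ i)} := by
    exact_mod_cast (card_le_card h3).trans (card_union_le _ _)
  linarith

/-- The Rademacher sum over a set. -/
def signSum (σ : ι → Bool) (A : Finset ι) : ℝ := ∑ i ∈ A, sgn (σ i)

/-- The weights `1_P - 1_Q` have square sum `#(P ∆ Q)`, so Rademacher sums over nearby sets are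
close. -/
lemma card_signSum_sub_gt_le (P Q : Finset ι) {s V : ℝ} (hs : 0 ≤ s) (hV : 0 < V)
    (hPQ : (#(P ∆ Q) : ℝ) ≤ V) :
    (#{σ : ι → Bool | s < |signSum σ P - signSum σ Q|} : ℝ) ≤
      2 ^ Fintype.card ι * (2 * Real.exp (-(s ^ 2 / (2 * V)))) := by
  have key := card_signs_abs_gt_le
    (fun i => (if i ∈ P then (1 : ℝ) else 0) - if i ∈ Q then 1 else 0) hs hV (by
      refine le_trans (le_of_eq ?_) hPQ
      have : ∀ i, ((if i ∈ P then (1 : ℝ) else 0) - if i ∈ Q then 1 else 0) ^ 2 =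
          if i ∈ P ∆ Q then 1 else 0 := fun i => by
        by_cases h1 : i ∈ P <;> by_cases h2 : i ∈ Q <;> simp [h1, h2, mem_symmDiff]
      simp [this])
  have e (σ : ι → Bool) : ∑ i, ((if i ∈ P then (1 : ℝ) else 0) - if i ∈ Q then 1 else 0) *
      sgn (σ i) = signSum σ P - signSum σ Q := by
    simp [sub_mul, signSum]
  simpa only [e] using key

lemma sum_succ_div_two_pow_le (J : ℕ) : ∑ j ∈ range J, ((j : ℝ) + 1) / 2 ^ (j + 1) ≤ 2 := by
  have : ∑ j ∈ range J, ((j : ℝ) + 1) / 2 ^ (j + 1) = 2 - (J + 2) / 2 ^ J := by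
    induction J with
    | zero => simp
    | succ J ih =>
      rw [sum_range_succ, ih]
      push_cast
      field_simp
      ring
  rw [this]
  have : (0 : ℝ) ≤ (J + 2) / 2 ^ J := by positivity
  linarith

/-- Multiscale nets for the family of sign patterns. -/
lemma exists_multiscale_nets {D : ℕ} (hD : 1 ≤ D) (z : ι → Fin D → ℝ)
    (hm : 0 < Fintype.card ι) :
    ∃ N : ℕ → Finset (Finset ι), (∀ j, Real.log #(N j) ≤ 10 * D ^ 2 * j) ∧
      (∀ j, (N j).Nonempty) ∧
      ∀ A ∈ patterns z, ∀ j, ∃ B ∈ N j, (#(A ∆ B) : ℝ) ≤ (1 / 4) ^ j * Fintype.card ι ∧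
        (0 < j → (#(A ∆ B) : ℝ) < (1 / 4) ^ j * Fintype.card ι) ∧ (j = 0 → B = ∅) := by
  have hm' : (0 : ℝ) < Fintype.card ι := by exact_mod_cast hm
  have hD' : (1 : ℝ) ≤ D := by exact_mod_cast hD
  choose N hN1 hN2 hN3 using fun j : ℕ => exists_separated_net (patterns z)
    (θ := (1 / 4) ^ j * Fintype.card ι) (by positivity)
  have hne : (patterns z).Nonempty :=
    ⟨univ, mem_patterns.2 ⟨0, fun i => by simp⟩⟩
  have hNne (j : ℕ) : (N j).Nonempty := by
    obtain ⟨A, hA⟩ := hne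
    obtain ⟨B, hB, -⟩ := hN3 j A hA
    exact ⟨B, hB⟩
  -- At scale `0` the empty set, possibly not a pattern, is within distance `m` of everything. It
  -- starts the chain at the value `0`.
  refine ⟨fun j => if j = 0 then {∅} else N j, fun j => ?_, fun j => ?_, fun A hA j => ?_⟩
  · rcases Nat.eq_zero_or_pos j with rfl | hj
    · simp
    · have hj' : (1 : ℝ) ≤ j := by exact_mod_cast hj
      simp only [hj.ne', if_false]
      refine (log_card_le_of_separated hD (hN1 j) hm (hNne j) (δ := (1 / 4) ^ j) (by positivity)
        (pow_le_one₀ (by norm_num) (by norm_num)) (hN2 j)).trans ?_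
      have h1 : Real.log (2 / (1 / 4) ^ j) ≤ 2 * j + 1 := by
        have e : (2 : ℝ) / (1 / 4) ^ j = 2 ^ (2 * j + 1) := by
          rw [pow_succ, pow_mul, one_div, inv_pow]
          norm_num
          ring
        rw [e, Real.log_pow]
        push_cast
        have := Real.log_two_lt_d9
        nlinarith
      have h2 : 2 * D * Real.log (2 / (1 / 4) ^ j) ≤ 2 * D * (2 * j + 1) := by gcongr
      have h3 : (D : ℝ) * j ≤ D ^ 2 * j := by gcongr; nlinarith
      have h4 : (D : ℝ) ^ 2 ≤ D ^ 2 * j := by nlinarith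
      have h5 : (D : ℝ) ≤ D * j := by nlinarith
      nlinarith
  · rcases eq_or_ne j 0 with rfl | hj
    · simp
    · simpa [hj] using hNne j
  · rcases Nat.eq_zero_or_pos j with rfl | hj
    · refine ⟨∅, by simp, ?_, by simp, fun _ => rfl⟩
      rw [pow_zero, one_mul, ← bot_eq_empty, symmDiff_bot]
      exact_mod_cast card_le_univ A
    · obtain ⟨B, hB, hAB⟩ := hN3 j A hA
      exact ⟨B, by simpa [hj.ne'] using hB, hAB.le, fun _ => hAB, fun h => absurd h hj.ne'⟩

/-- Rademacher sums are uniformly small over the sign patterns of halfspaces, with no logarithmic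
factor: the proof chains through the scales `4 ^ (-j)`. -/
theorem card_signs_exists_pattern_le {D : ℕ} (hD : 1 ≤ D) (z : ι → Fin D → ℝ)
    (hm : 0 < Fintype.card ι) {ε δ : ℝ} (hε : 0 < ε) (hδ : 0 < δ) (hδ1 : δ ≤ 1)
    (h : 20 * D ^ 2 + Real.log (4 / δ) ≤ Fintype.card ι * ε ^ 2 / 40) :
    (Nat.card {σ : ι → Bool // ∃ A ∈ patterns z, Fintype.card ι * ε < |signSum σ A|} : ℝ) ≤
      2 ^ Fintype.card ι * δ := by
  classical
  set m := Fintype.card ι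
  have hm' : (0 : ℝ) < m := by exact_mod_cast hm
  obtain ⟨N, hlog, hNne, hN⟩ := exists_multiscale_nets hD z hm
  -- At level `J + 1` the net radius is below one point, so the approximation of `A` is `A` itself
  -- and the chain ends exactly.
  obtain ⟨J, hJ⟩ : ∃ J : ℕ, (1 / 4 : ℝ) ^ (J + 1) * m < 1 := by
    obtain ⟨J, hJ⟩ := exists_pow_lt_of_lt_one (show 0 < 1 / (m : ℝ) by positivity)
      (show (1 / 4 : ℝ) < 1 by norm_num)
    refine ⟨J, ?_⟩
    rw [lt_div_iff₀ hm'] at hJ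
    rw [pow_succ]
    nlinarith
  -- The thresholds add up to at most `m ε`; `V j` is the sum of the two net radii at levels `j` and
  -- `j + 1`. The factor `j + 1` makes the Hoeffding exponent `m ε² / 40 * (j + 1)²`, which beats
  -- the entropy `10 D² (2 j + 1)` of the pairs.
  let s : ℕ → ℝ := fun j => m * ε * ((j + 1) / 2 ^ (j + 1)) / 2
  let V : ℕ → ℝ := fun j => 5 * ((1 / 4) ^ (j + 1) * m)
  let bad : ℕ → Finset (ι → Bool) := fun j =>
    ((N (j + 1) ×ˢ N j).filter fun q => (#(q.1 ∆ q.2) : ℝ) ≤ V j).biUnion fun q =>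
      {σ : ι → Bool | s j < |signSum σ q.1 - signSum σ q.2|}
  have hsub : ({σ : ι → Bool | ∃ A ∈ patterns z, m * ε < |signSum σ A|} : Finset _) ⊆
      (range (J + 1)).biUnion bad := by
    intro σ hσ
    obtain ⟨A, hA, hAσ⟩ := (mem_filter.1 hσ).2
    by_contra hcon
    choose π hπN hπ hπlt hπ0 using hN A hA
    have hstep (j : ℕ) (hj : j ∈ range (J + 1)) :
        |signSum σ (π (j + 1)) - signSum σ (π j)| ≤ s j := by
      by_contra! hlt
      refine hcon (mem_biUnion.2 ⟨j, hj, mem_biUnion.2 ⟨(π (j + 1), π j), mem_filter.2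
        ⟨mem_product.2 ⟨hπN _, hπN _⟩, ?_⟩, by simpa using hlt⟩⟩)
      have h1 : #(π (j + 1) ∆ π j) ≤ #(A ∆ π (j + 1)) + #(A ∆ π j) := by
        refine (card_le_card ?_).trans (card_union_le _ _)
        rw [symmDiff_comm A (π (j + 1))]
        exact symmDiff_triangle _ A _
      have h2 := hπ (j + 1)
      have h3 := hπ j
      have h4 : (#(π (j + 1) ∆ π j) : ℝ) ≤ #(A ∆ π (j + 1)) + #(A ∆ π j) := by exact_mod_cast h1
      refine h4.trans ((add_le_add h2 h3).trans_eq ?_)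
      simp only [V]
      rw [pow_succ]
      ring
    have hAJ : π (J + 1) = A := by
      have h0 := (hπlt (J + 1) J.succ_pos).trans hJ
      have h1 : #(A ∆ π (J + 1)) = 0 := by
        have : (#(A ∆ π (J + 1)) : ℝ) < ((1 : ℕ) : ℝ) := by simpa using h0
        have := Nat.cast_lt.1 this
        omega
      exact (symmDiff_eq_bot.1 (card_eq_zero.1 h1)).symm
    have htel : signSum σ A = ∑ j ∈ range (J + 1), (signSum σ (π (j + 1)) - signSum σ (π j)) := by
      rw [sum_range_sub fun j => signSum σ (π j), hAJ, hπ0 0 rfl]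
      simp [signSum]
    refine absurd hAσ (not_lt.2 ?_)
    rw [htel]
    refine (abs_sum_le_sum_abs _ _).trans ((sum_le_sum hstep).trans ?_)
    have := sum_succ_div_two_pow_le (J + 1)
    simp only [s]
    rw [← sum_div, ← mul_sum]
    have hmε : 0 ≤ m * ε := by positivity
    nlinarith
  have hbad (j : ℕ) : (#(bad j) : ℝ) ≤ 2 ^ m * (2 * (δ / 4) ^ (j + 1)) := by
    have hsj : 0 ≤ s j := by positivity
    have hVj : 0 < V j := by positivity
    have h1 : (#(bad j) : ℝ) ≤ ∑ q ∈ N (j + 1) ×ˢ N j,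
        2 ^ m * (2 * Real.exp (-(s j ^ 2 / (2 * V j)))) := by
      have : (#(bad j) : ℝ) ≤
          ∑ q ∈ (N (j + 1) ×ˢ N j).filter fun q => (#(q.1 ∆ q.2) : ℝ) ≤ V j,
            (#{σ : ι → Bool | s j < |signSum σ q.1 - signSum σ q.2|} : ℝ) := by
        exact_mod_cast card_biUnion_le
      refine this.trans ((sum_le_sum fun q hq => card_signSum_sub_gt_le q.1 q.2 hsj hVj
        (mem_filter.1 hq).2).trans ?_)
      exact sum_le_sum_of_subset_of_nonneg (filter_subset _ _) fun _ _ _ => by positivity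
    rw [sum_const, card_product, nsmul_eq_mul, Nat.cast_mul] at h1
    have hc (i : ℕ) : (0 : ℝ) < #(N i) := by exact_mod_cast (hNne i).card_pos
    have hexp (i : ℕ) : (#(N i) : ℝ) ≤ Real.exp (10 * D ^ 2 * i) :=
      (Real.log_le_iff_le_exp (hc i)).1 (hlog i)
    have hs2 : s j ^ 2 / (2 * V j) = m * ε ^ 2 / 40 * (j + 1) ^ 2 := by
      simp only [s, V]
      have : ((1 : ℝ) / 4) ^ (j + 1) = 1 / (2 ^ (j + 1)) ^ 2 := by
        rw [one_div_pow, ← pow_mul, mul_comm, pow_mul]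
        norm_num
      rw [this]
      field_simp
      ring
    have hexp2 : Real.exp (10 * D ^ 2 * (j + 1 : ℕ)) * Real.exp (10 * D ^ 2 * j) *
        Real.exp (-(s j ^ 2 / (2 * V j))) ≤ (δ / 4) ^ (j + 1) := by
      have hlogδ : Real.exp (-Real.log (4 / δ)) = δ / 4 := by
        rw [← Real.log_inv, Real.exp_log (by positivity), inv_div]
      rw [← hlogδ, ← Real.exp_nat_mul, ← Real.exp_add, ← Real.exp_add, hs2]
      refine Real.exp_le_exp.2 ?_
      push_cast
      have hj : (0 : ℝ) ≤ j := Nat.cast_nonneg _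
      have hl : 0 ≤ Real.log (4 / δ) := Real.log_nonneg (by rw [le_div_iff₀ hδ]; linarith)
      have hX : 0 ≤ m * ε ^ 2 / 40 := by positivity
      have hD2 : (0 : ℝ) ≤ D ^ 2 := by positivity
      have e1 : (20 * D ^ 2 + Real.log (4 / δ)) * ((j : ℝ) + 1) ≤
          m * ε ^ 2 / 40 * ((j : ℝ) + 1) := by gcongr
      have e2 : m * ε ^ 2 / 40 * ((j : ℝ) + 1) ≤ m * ε ^ 2 / 40 * ((j : ℝ) + 1) ^ 2 := by
        gcongr
        nlinarith
      nlinarith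
    calc (#(bad j) : ℝ) ≤ #(N (j + 1)) * #(N j) *
          (2 ^ m * (2 * Real.exp (-(s j ^ 2 / (2 * V j))))) := h1
      _ ≤ Real.exp (10 * D ^ 2 * (j + 1 : ℕ)) * Real.exp (10 * D ^ 2 * j) *
          (2 ^ m * (2 * Real.exp (-(s j ^ 2 / (2 * V j))))) := by
            gcongr
            · exact hexp _
            · exact hexp _
      _ = 2 ^ m * (2 * (Real.exp (10 * D ^ 2 * (j + 1 : ℕ)) * Real.exp (10 * D ^ 2 * j) *
          Real.exp (-(s j ^ 2 / (2 * V j))))) := by ring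
      _ ≤ _ := by gcongr
  have hgeom : ∑ j ∈ range (J + 1), 2 * (δ / 4) ^ (j + 1) ≤ δ := by
    have hg : ∑ j ∈ range (J + 1), (δ / 4) ^ (j + 1) ≤ ∑ j ∈ range (J + 1),
        (δ / 4) * (1 / 2) ^ j := by
      refine sum_le_sum fun j _ => ?_
      rw [pow_succ']
      gcongr
      linarith
    rw [← mul_sum] at hg ⊢
    have h2 : ∑ j ∈ range (J + 1), (1 / 2 : ℝ) ^ j ≤ 2 := sum_geometric_two_le _
    nlinarith
  have hcard : (#{σ : ι → Bool | ∃ A ∈ patterns z, m * ε < |signSum σ A|} : ℝ) ≤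
      ∑ j ∈ range (J + 1), (#(bad j) : ℝ) := by
    exact_mod_cast (card_le_card hsub).trans card_biUnion_le
  rw [Nat.card_eq_fintype_card, Fintype.card_subtype]
  refine hcard.trans ((sum_le_sum fun j _ => hbad j).trans ?_)
  rw [← mul_sum]
  gcongr

end Chaining

end InitialList

namespace InitialList

open Finset
open scoped symmDiff ENNReal

/-! ### Symmetrization and uniform convergence -/

section Symmetrization

/-- The indices of the points that lie in the halfspace `{z | 0 ≤ a ⬝ᵥ z}`. -/
noncomputable def hits {ι : Type*} [Fintype ι] {D : ℕ} (a : Fin D → ℝ) (x : ι → Fin D → ℝ) :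
    Finset ι :=
  univ.filter fun i => 0 ≤ a ⬝ᵥ x i

lemma hits_mem_patterns {ι : Type*} [Fintype ι] {D : ℕ} (a : Fin D → ℝ) (x : ι → Fin D → ℝ) :
    hits a x ∈ patterns x :=
  mem_patterns.2 ⟨a, fun i => by simp [hits]⟩

/-- The quantifier over `a` is uncountable. Rescaling `a` turns the strict inequalities into `≤ -1`,
so the set is the projection of a closed, hence σ-compact, set. -/
lemma measurableSet_mem_patterns {κ : Type*} [Fintype κ] {D : ℕ} (T : Finset κ) :
    MeasurableSet {w : κ → Fin D → ℝ | T ∈ patterns w} := by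
  classical
  let F : Set ((Fin D → ℝ) × (κ → Fin D → ℝ)) :=
    {q | (∀ i ∈ T, 0 ≤ q.1 ⬝ᵥ q.2 i) ∧ ∀ i ∈ Tᶜ, q.1 ⬝ᵥ q.2 i ≤ -1}
  have hF : IsClosed F := by
    simp only [F, Set.ofPred_and, Set.ofPred_forall]
    refine IsClosed.inter ?_ ?_ <;>
      refine isClosed_iInter fun i => isClosed_iInter fun _ => isClosed_le ?_ ?_ <;>
      first | exact continuous_const | (simp only [dotProduct]; fun_prop)
  have hproj : {w : κ → Fin D → ℝ | T ∈ patterns w} = Prod.snd '' F := by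
    ext w
    simp only [Set.mem_ofPred_eq, mem_patterns, Set.mem_image, Prod.exists, exists_eq_right, F]
    constructor
    · rintro ⟨a, ha⟩
      have hneg (i : κ) (hi : i ∈ Tᶜ) : 0 < -(a ⬝ᵥ w i) := by
        rw [mem_compl, ha, not_le] at hi
        linarith
      -- The factor dominates each reciprocal, so every negative value is pushed to `-1` or below at
      -- once.
      refine ⟨(∑ i ∈ Tᶜ, (-(a ⬝ᵥ w i))⁻¹) • a, fun i hi => ?_, fun i hi => ?_⟩
      · rw [smul_dotProduct, smul_eq_mul]
        exact mul_nonneg (sum_nonneg fun j hj => (inv_pos.2 (hneg j hj)).le) ((ha i).1 hi)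
      · have h1 : (-(a ⬝ᵥ w i))⁻¹ ≤ ∑ i ∈ Tᶜ, (-(a ⬝ᵥ w i))⁻¹ :=
          single_le_sum (f := fun i => (-(a ⬝ᵥ w i))⁻¹)
            (fun j hj => (inv_pos.2 (hneg j hj)).le) hi
        have h2 := mul_le_mul_of_nonneg_right h1 (hneg i hi).le
        rw [inv_mul_cancel₀ (hneg i hi).ne'] at h2
        rw [smul_dotProduct, smul_eq_mul]
        linarith
    · rintro ⟨a, h1, h2⟩
      refine ⟨a, fun i => ⟨h1 i, fun h => ?_⟩⟩
      by_contra hi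
      linarith [h2 i (mem_compl.2 hi)]
  rw [hproj]
  obtain ⟨K, hK, hKF⟩ := (isSigmaCompact_univ.of_isClosed_subset hF (Set.subset_univ _)).image
    continuous_snd
  rw [← hKF]
  exact MeasurableSet.iUnion fun n => (hK n).measurableSet

variable {ι : Type*} [Fintype ι] {D : ℕ}

/-- The event that some halfspace has rather different frequencies in the two halves of a double
sample. -/
def discrepant (t : ℝ) : Set (ι ⊕ ι → Fin D → ℝ) :=
  {w | ∃ a : Fin D → ℝ,
    t < |(#(hits a fun i => w (.inl i)) : ℝ) - #(hits a fun i => w (.inr i))|}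

lemma measurableSet_discrepant (t : ℝ) :
    MeasurableSet (discrepant t : Set (ι ⊕ ι → Fin D → ℝ)) := by
  have h : (discrepant t : Set (ι ⊕ ι → Fin D → ℝ)) =
      ⋃ T ∈ {T : Finset (ι ⊕ ι) | t < |(#T.toLeft : ℝ) - #T.toRight|},
        {w : ι ⊕ ι → Fin D → ℝ | T ∈ patterns w} := by
    ext w
    simp only [discrepant, Set.mem_ofPred_eq, Set.mem_iUnion, exists_prop]
    have e1 (a : Fin D → ℝ) : (hits a w).toLeft = hits a fun i => w (.inl i) := by
      ext; simp [hits]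
    have e2 (a : Fin D → ℝ) : (hits a w).toRight = hits a fun i => w (.inr i) := by
      ext; simp [hits]
    constructor
    · rintro ⟨a, ha⟩
      exact ⟨hits a w, by rwa [e1, e2], hits_mem_patterns a w⟩
    · rintro ⟨T, hT, hTw⟩
      obtain ⟨a, ha⟩ := mem_patterns.1 hTw
      have : T = hits a w := by ext i; simp [hits, ha]
      exact ⟨a, by rwa [← e1, ← e2, ← this]⟩
  rw [h]
  exact MeasurableSet.biUnion (Set.to_countable _) fun T _ => measurableSet_mem_patterns T

/-- The permutation of a double index set that exchanges the two copies of `i` when `σ i` is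
false. -/
def swapPerm (σ : ι → Bool) : Equiv.Perm (ι ⊕ ι) :=
  Function.Involutive.toPerm
    (fun
      | .inl i => if σ i then .inl i else .inr i
      | .inr i => if σ i then .inr i else .inl i) (by
    rintro (i | i) <;> cases h : σ i <;> simp [h])

/-- Exchanging a pair flips the sign of its contribution, which turns random swaps into Rademacher
sums. -/
lemma hits_sub_hits_swapPerm (σ : ι → Bool) (a : Fin D → ℝ) (w : ι ⊕ ι → Fin D → ℝ) :
    (#(hits a fun i => w (swapPerm σ (.inl i))) : ℝ) - #(hits a fun i => w (swapPerm σ (.inr i))) =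
      signSum σ (hits a fun i => w (.inl i)) - signSum σ (hits a fun i => w (.inr i)) := by
  simp only [hits, card_filter, signSum, sum_filter, Nat.cast_sum, ← sum_sub_distrib]
  refine sum_congr rfl fun i _ => ?_
  cases h : σ i
  · simp only [swapPerm, Function.Involutive.toPerm, sgn, h, Equiv.coe_fn_mk]
    split_ifs <;> simp_all
  · simp [swapPerm, Function.Involutive.toPerm, sgn, h]

lemma measurePreserving_comp_perm {κ E : Type*} [Fintype κ] [MeasurableSpace E] (ν : Measure E)
    [SigmaFinite ν] (e : Equiv.Perm κ) :
    MeasurePreserving (fun (w : κ → E) i => w (e i)) (Measure.pi fun _ => ν)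
      (Measure.pi fun _ => ν) := by
  have := measurePreserving_arrowCongr' (fun _ : κ => ν) (fun _ : κ => ν) e.symm
    (MeasurableEquiv.refl E) (fun _ => MeasurePreserving.id ν)
  exact this

/-- The law of the double sample is invariant under swaps, so the event may be averaged over all `2
^ m` of them. For a fixed double sample, a discrepancy above `2 m ε` forces one of two Rademacher
sums above `m ε`, which happens for at most `2 ^ m * (2 δ)` swaps. -/
lemma measure_discrepant_le (hD : 1 ≤ D) (hm : 0 < Fintype.card ι) (ν : Measure (Fin D → ℝ))
    [IsProbabilityMeasure ν] {ε δ : ℝ} (hε : 0 < ε) (hδ : 0 < δ) (hδ1 : δ ≤ 1)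
    (h : 20 * D ^ 2 + Real.log (4 / δ) ≤ Fintype.card ι * ε ^ 2 / 40) :
    Measure.pi (fun _ : ι ⊕ ι => ν) (discrepant (2 * (Fintype.card ι * ε))) ≤
      ENNReal.ofReal (2 * δ) := by
  classical
  set m := Fintype.card ι
  set Q := Measure.pi (fun _ : ι ⊕ ι => ν)
  set B : Set (ι ⊕ ι → Fin D → ℝ) := discrepant (2 * (m * ε))
  have hB : MeasurableSet B := measurableSet_discrepant _
  let f (σ : ι → Bool) (w : ι ⊕ ι → Fin D → ℝ) : ι ⊕ ι → Fin D → ℝ := fun i => w (swapPerm σ i)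
  have hf (σ : ι → Bool) : MeasurePreserving (f σ) Q Q := measurePreserving_comp_perm ν _
  have hpoint (w : ι ⊕ ι → Fin D → ℝ) :
      ∑ σ : ι → Bool, (f σ ⁻¹' B).indicator (1 : (ι ⊕ ι → Fin D → ℝ) → ℝ≥0∞) w ≤
        ENNReal.ofReal (2 ^ m * (2 * δ)) := by
    have h1 : ∑ σ : ι → Bool, (f σ ⁻¹' B).indicator (1 : (ι ⊕ ι → Fin D → ℝ) → ℝ≥0∞) w =
        (#(univ.filter fun σ : ι → Bool => f σ w ∈ B) : ℝ≥0∞) := by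
      simp [Set.indicator_apply]
    rw [h1, ← ENNReal.ofReal_natCast]
    refine ENNReal.ofReal_le_ofReal ?_
    have hl := card_signs_exists_pattern_le hD (fun i => w (.inl i)) hm hε hδ hδ1 h
    have hr := card_signs_exists_pattern_le hD (fun i => w (.inr i)) hm hε hδ hδ1 h
    rw [Nat.card_eq_fintype_card, Fintype.card_subtype] at hl hr
    have hsub : (univ.filter fun σ : ι → Bool => f σ w ∈ B) ⊆
        (univ.filter fun σ : ι → Bool =>
          ∃ A ∈ patterns fun i => w (.inl i), m * ε < |signSum σ A|) ∪
        (univ.filter fun σ : ι → Bool =>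
          ∃ A ∈ patterns fun i => w (.inr i), m * ε < |signSum σ A|) := by
      intro σ hσ
      obtain ⟨a, ha⟩ := (mem_filter.1 hσ).2
      rw [hits_sub_hits_swapPerm] at ha
      by_contra hcon
      simp only [mem_union, mem_filter, mem_univ, true_and, not_or, not_exists, not_and,
        not_lt] at hcon
      have h1 := hcon.1 _ (hits_mem_patterns a _)
      have h2 := hcon.2 _ (hits_mem_patterns a _)
      have h3 := abs_sub (signSum σ (hits a fun i => w (.inl i)))
        (signSum σ (hits a fun i => w (.inr i)))
      linarith
    have hc : (#(univ.filter fun σ : ι → Bool => f σ w ∈ B) : ℝ) ≤ _ :=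
      Nat.cast_le.2 ((card_le_card hsub).trans (card_union_le _ _))
    rw [Nat.cast_add] at hc
    linarith
  have hint : ∑ σ : ι → Bool, Q (f σ ⁻¹' B) ≤ ENNReal.ofReal (2 ^ m * (2 * δ)) := by
    calc ∑ σ : ι → Bool, Q (f σ ⁻¹' B)
        = ∫⁻ w, ∑ σ : ι → Bool, (f σ ⁻¹' B).indicator (1 : (ι ⊕ ι → Fin D → ℝ) → ℝ≥0∞) w ∂Q := by
          rw [lintegral_finsetSum _ fun σ _ =>
            measurable_one.indicator ((hf σ).measurable hB)]
          exact sum_congr rfl fun σ _ => (lintegral_indicator_one ((hf σ).measurable hB)).symm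
      _ ≤ ∫⁻ _, ENNReal.ofReal (2 ^ m * (2 * δ)) ∂Q := lintegral_mono hpoint
      _ = _ := by simp
  simp only [(hf _).measure_preimage hB.nullMeasurableSet, sum_const, card_univ,
    Fintype.card_fun, Fintype.card_bool, nsmul_eq_mul] at hint
  rw [ENNReal.ofReal_mul (by positivity)] at hint
  have e : ENNReal.ofReal (2 ^ m) = ((2 ^ m : ℕ) : ℝ≥0∞) := by
    rw [← ENNReal.ofReal_natCast]; push_cast; rfl
  rw [e] at hint
  exact (ENNReal.mul_le_mul_iff_right (by simp) (ENNReal.natCast_ne_top _)).1 hint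

/-- Chebyshev's inequality for the empirical frequency of a set. -/
lemma measure_frequency_deviation_le {E : Type*} [MeasurableSpace E] (ν : Measure E)
    [IsProbabilityMeasure ν] {H : Set E} (hH : MeasurableSet H) [DecidablePred (· ∈ H)]
    (hm : 0 < Fintype.card ι) {ε : ℝ} (hε : 0 < ε) (h : 2 ≤ Fintype.card ι * ε ^ 2) :
    Measure.pi (fun _ : ι => ν)
      {y | Fintype.card ι * ε / 2 ≤ |(#{i | y i ∈ H} : ℝ) - Fintype.card ι * ν.real H|} ≤ 2⁻¹ := by
  set m := Fintype.card ι
  have hm' : (0 : ℝ) < m := by exact_mod_cast hm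
  set Q := Measure.pi (fun _ : ι => ν)
  let g : E → ℝ := H.indicator 1
  have hg : Measurable g := measurable_one.indicator hH
  let Y (i : ι) (y : ι → E) : ℝ := g (y i)
  have hY (i : ι) : Measurable (Y i) := hg.comp (measurable_pi_apply i)
  have hY01 (i : ι) (y : ι → E) : Y i y ∈ Set.Icc (0 : ℝ) 1 := by
    simp only [Y, g, Set.indicator_apply]
    split_ifs <;> simp
  have hYL (i : ι) : MemLp (Y i) 2 Q := by
    refine MemLp.of_bound (hY i).aestronglyMeasurable 1 (Filter.Eventually.of_forall fun y => ?_)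
    rw [Real.norm_eq_abs, abs_le]
    constructor <;> linarith [(hY01 i y).1, (hY01 i y).2]
  have hindep : iIndepFun Y Q := iIndepFun_pi fun _ => hg.aemeasurable
  have hvar : Var[∑ i, Y i; Q] ≤ m / 4 := by
    rw [IndepFun.variance_sum (fun i _ => hYL i) fun i _ j _ hij => hindep.indepFun hij]
    calc ∑ i, Var[Y i; Q] ≤ ∑ _i : ι, (1 / 4 : ℝ) := sum_le_sum fun i _ =>
          (variance_le_sq_of_bounded (Filter.Eventually.of_forall (hY01 i))
            (hY i).aemeasurable).trans_eq (by norm_num)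
      _ = m / 4 := by simp [m]; ring
  have hmean : ∫ y, (∑ i, Y i) y ∂Q = m * ν.real H := by
    simp only [Finset.sum_apply]
    rw [integral_finsetSum _ fun i _ => (hYL i).integrable (by norm_num)]
    have (i : ι) : ∫ y, Y i y ∂Q = ν.real H := by
      simp only [Y, Q]
      rw [integral_comp_eval (μ := fun _ : ι => ν) (f := g) hg.aestronglyMeasurable]
      exact integral_indicator_one hH
    simp [this, m]
  have hcount (y : ι → E) : (∑ i, Y i) y = (#{i | y i ∈ H} : ℝ) := by
    simp [Y, g, Set.indicator_apply]
  have key := meas_ge_le_variance_div_sq (μ := Q) (X := ∑ i, Y i)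
    (memLp_finsetSum' _ fun i _ => hYL i) (c := m * ε / 2) (by positivity)
  rw [hmean] at key
  simp only [hcount] at key
  refine key.trans ?_
  -- The variance is at most `m / 4`, so the quotient is at most `1 / (m ε²)`.
  have : Var[∑ i, Y i; Q] / (m * ε / 2) ^ 2 ≤ 1 / 2 := by
    rw [div_le_iff₀ (by positivity)]
    nlinarith
  refine (ENNReal.ofReal_le_ofReal this).trans_eq ?_
  rw [one_div, ENNReal.ofReal_inv_of_pos (by norm_num)]
  simp

/-- Uniform convergence of the empirical frequencies of homogeneous halfspaces, with the optimal
rate. -/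
theorem measure_exists_halfspace_deviation_le (hD : 1 ≤ D) (hm : 0 < Fintype.card ι)
    (ν : Measure (Fin D → ℝ)) [IsProbabilityMeasure ν] {ε δ : ℝ} (hε : 0 < ε) (hδ : 0 < δ)
    (hδ1 : δ ≤ 1)
    (h : 20 * D ^ 2 + Real.log (4 / δ) ≤ Fintype.card ι * ε ^ 2 / 640) :
    Measure.pi (fun _ : ι => ν)
      {x | ∃ a : Fin D → ℝ, ε < |ν.real {z | 0 ≤ a ⬝ᵥ z} - #(hits a x) / Fintype.card ι|} ≤
        ENNReal.ofReal (4 * δ) := by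
  set m := Fintype.card ι
  have hm' : (0 : ℝ) < m := by exact_mod_cast hm
  set Q := Measure.pi (fun _ : ι => ν)
  -- A deviation above `m ε` in one half and below `m ε / 2` in the other leaves a discrepancy above
  -- `m ε / 2 = 2 (m ε / 4)`; thus `640 = 40 * 4²`.
  have hdis := measure_discrepant_le (ι := ι) hD hm ν (ε := ε / 4) (by positivity) hδ hδ1
    (h.trans_eq (by ring))
  rw [← (measurePreserving_sumPiEquivProdPi_symm (fun _ : ι ⊕ ι => ν)).measure_preimage
    (measurableSet_discrepant _).nullMeasurableSet] at hdis
  set B' := (MeasurableEquiv.sumPiEquivProdPi fun _ : ι ⊕ ι => Fin D → ℝ).symm ⁻¹'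
    discrepant (2 * (m * (ε / 4)))
  have hB' : MeasurableSet B' :=
    (MeasurableEquiv.measurable _) (measurableSet_discrepant _)
  rw [Measure.prod_apply hB'] at hdis
  -- For a bad `x`, a fixed bad halfspace is well estimated by the ghost sample with probability at
  -- least `1 / 2`. The superset on the right is measurable, and Markov's inequality bounds it by
  -- twice the probability of discrepancy.
  have hsub : {x | ∃ a : Fin D → ℝ, ε < |ν.real {z | 0 ≤ a ⬝ᵥ z} - #(hits a x) / m|} ⊆
      {x | (2⁻¹ : ℝ≥0∞) ≤ Q (Prod.mk x ⁻¹' B')} := by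
    rintro x ⟨a, ha⟩
    have hH : MeasurableSet {z : Fin D → ℝ | 0 ≤ a ⬝ᵥ z} := by
      simp only [dotProduct]
      exact measurableSet_le measurable_const (by fun_prop)
    have hcheb := measure_frequency_deviation_le (ι := ι) ν hH hm hε (by
      have : 0 ≤ Real.log (4 / δ) := Real.log_nonneg (by rw [le_div_iff₀ hδ]; linarith)
      have : (1 : ℝ) ≤ D ^ 2 := by exact_mod_cast Nat.one_le_pow _ _ hD
      linarith)
    set S := {y : ι → Fin D → ℝ | (m : ℝ) * ε / 2 ≤
      |(#{i | y i ∈ {z : Fin D → ℝ | 0 ≤ a ⬝ᵥ z}} : ℝ) - m * ν.real {z | 0 ≤ a ⬝ᵥ z}|}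
    have hSB : Sᶜ ⊆ Prod.mk x ⁻¹' B' := by
      intro y hy
      refine ⟨a, ?_⟩
      have hy' : |(#(hits a y) : ℝ) - m * ν.real {z | 0 ≤ a ⬝ᵥ z}| < m * ε / 2 := not_le.1 hy
      have hx' : m * ε < |(#(hits a x) : ℝ) - m * ν.real {z | 0 ≤ a ⬝ᵥ z}| := by
        have e : (#(hits a x) : ℝ) - m * ν.real {z | 0 ≤ a ⬝ᵥ z} =
            -(m * (ν.real {z | 0 ≤ a ⬝ᵥ z} - #(hits a x) / m)) := by field_simp; ring
        rw [e, abs_neg, abs_mul, abs_of_pos hm']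
        gcongr
      change 2 * (m * (ε / 4)) < |(#(hits a x) : ℝ) - #(hits a y)|
      have := abs_sub_le (#(hits a x) : ℝ) (#(hits a y)) (m * ν.real {z | 0 ≤ a ⬝ᵥ z})
      linarith
    refine le_trans ?_ (measure_mono hSB)
    have h1 : (1 : ℝ≥0∞) ≤ Q S + Q Sᶜ := by
      rw [← measure_univ (μ := Q)]
      exact measure_univ_le_add_compl S
    by_contra! hlt
    have h2 := ENNReal.add_lt_add_of_le_of_lt (by finiteness) hcheb hlt
    rw [ENNReal.inv_two_add_inv_two] at h2
    exact absurd h1 (not_le.2 h2)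
  have hmk := (mul_meas_ge_le_lintegral (μ := Q) (measurable_measure_prodMk_left (ν := Q) hB')
    2⁻¹).trans hdis
  refine (measure_mono hsub).trans ?_
  have h2 : (2 : ℝ≥0∞) * (2⁻¹ * Q {x | (2⁻¹ : ℝ≥0∞) ≤ Q (Prod.mk x ⁻¹' B')}) ≤
      2 * ENNReal.ofReal (2 * δ) := by gcongr
  rw [← mul_assoc, ENNReal.mul_inv_cancel (by norm_num) (by norm_num), one_mul] at h2
  refine h2.trans_eq ?_
  rw [show (4 : ℝ) * δ = 2 * (2 * δ) by ring, ENNReal.ofReal_mul (by norm_num) (q := 2 * δ)]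
  simp

/-- Uniform convergence for the sets cut out by a linear space of functions, in terms of a feature
map `φ`. -/
theorem measure_exists_feature_deviation_le {E : Type*} [MeasurableSpace E] (hD : 1 ≤ D)
    (hm : 0 < Fintype.card ι) (G : Measure E) [IsProbabilityMeasure G] {φ : E → Fin D → ℝ}
    (hφ : Measurable φ) {ε δ : ℝ} (hε : 0 < ε) (hδ : 0 < δ) (hδ1 : δ ≤ 1)
    (h : 20 * D ^ 2 + Real.log (4 / δ) ≤ Fintype.card ι * ε ^ 2 / 640) :
    Measure.pi (fun _ : ι => G)
      {x | ∃ a : Fin D → ℝ, ε < |G.real {z | 0 ≤ a ⬝ᵥ φ z} -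
        #{i | 0 ≤ a ⬝ᵥ φ (x i)} / Fintype.card ι|} ≤ ENNReal.ofReal (4 * δ) := by
  have : IsProbabilityMeasure (G.map φ) := Measure.isProbabilityMeasure_map hφ.aemeasurable
  refine le_trans ?_ (measure_exists_halfspace_deviation_le (ι := ι) hD hm (G.map φ) hε hδ hδ1 h)
  rw [← Measure.pi_map_pi (μ := fun _ : ι => G) fun _ => hφ.aemeasurable]
  refine le_trans (measure_mono ?_) (Measure.le_map_apply
    (measurable_pi_lambda _ fun i => hφ.comp (measurable_pi_apply i)).aemeasurable _)
  rintro x ⟨a, ha⟩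
  refine ⟨a, ?_⟩
  have hH : MeasurableSet {z : Fin D → ℝ | 0 ≤ a ⬝ᵥ z} := by
    simp only [dotProduct]
    exact measurableSet_le measurable_const (by fun_prop)
  rwa [map_measureReal_apply hφ hH]

end Symmetrization

end InitialList

namespace InitialList

open Finset
open scoped ENNReal

/-! ### Gaussian concentration in the `ℓ∞` norm -/

section GaussianTail

instance isProbabilityMeasure_gaussian {d : ℕ} (μ : Fin d → ℝ) :
    IsProbabilityMeasure (gaussian μ) := by
  unfold gaussian
  infer_instance

lemma gaussianReal_abs_sub_ge_le (m : ℝ) {r : ℝ} (hr : 0 ≤ r) :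
    gaussianReal m 1 {t | r ≤ |t - m|} ≤ ENNReal.ofReal (2 * Real.exp (-r ^ 2 / 2)) := by
  have hmap : (gaussianReal m 1).map (fun t => t - m) = gaussianReal 0 1 := by
    rw [gaussianReal_map_sub_const, sub_self]
  have hsub : HasSubgaussianMGF (fun t : ℝ => t) 1 (gaussianReal 0 1) :=
    { integrable_exp_mul := fun t => integrable_exp_mul_gaussianReal t
      mgf_le := fun t => by
        have := congrFun (mgf_id_gaussianReal (μ := 0) (v := 1)) t
        rw [show (fun t : ℝ => t) = id from rfl, this]
        simp }
  have h1 := hsub.measure_ge_le hr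
  have h2 := hsub.neg.measure_ge_le hr
  have hms : MeasurableSet {t : ℝ | r ≤ |t|} := measurableSet_le (by fun_prop) (by fun_prop)
  have : gaussianReal m 1 {t | r ≤ |t - m|} = gaussianReal 0 1 {t | r ≤ |t|} := by
    rw [← hmap, Measure.map_apply (by fun_prop) hms]
    rfl
  rw [this, ← ofReal_measureReal]
  refine ENNReal.ofReal_le_ofReal ?_
  have h3 : (gaussianReal 0 1).real {t : ℝ | r ≤ |t|} ≤
      (gaussianReal 0 1).real ({t : ℝ | r ≤ t} ∪ {t : ℝ | r ≤ -t}) :=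
    measureReal_mono fun t (ht : r ≤ |t|) => (le_abs.1 ht : r ≤ t ∨ r ≤ -t)
  have h4 := h3.trans (measureReal_union_le _ _)
  simp only [Pi.neg_apply, NNReal.coe_one, mul_one] at h1 h2
  linarith

lemma gaussian_norm_sub_le {d : ℕ} (μ : Fin d → ℝ) {r : ℝ} (hr : 0 ≤ r) :
    1 - 2 * d * Real.exp (-r ^ 2 / 2) ≤ (gaussian μ).real {x | ‖x - μ‖ ≤ r} := by
  have hms : MeasurableSet {x : Fin d → ℝ | ‖x - μ‖ ≤ r} :=
    measurableSet_le (by fun_prop) (by fun_prop)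
  have hsub : {x : Fin d → ℝ | ‖x - μ‖ ≤ r}ᶜ ⊆ ⋃ i, {x | r ≤ |x i - μ i|} := by
    intro x hx
    by_contra hcon
    simp only [Set.mem_iUnion, Set.mem_ofPred_eq, not_exists, not_le] at hcon
    exact hx ((pi_norm_le_iff_of_nonneg hr).2 fun i => (hcon i).le)
  have hle : gaussian μ {x : Fin d → ℝ | ‖x - μ‖ ≤ r}ᶜ ≤
      ENNReal.ofReal (2 * d * Real.exp (-r ^ 2 / 2)) := by
    refine (measure_mono hsub).trans ((measure_iUnion_le _).trans ?_)
    rw [tsum_fintype]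
    have hi (i : Fin d) : gaussian μ {x | r ≤ |x i - μ i|} ≤
        ENNReal.ofReal (2 * Real.exp (-r ^ 2 / 2)) := by
      have hmp := measurePreserving_eval (fun i => gaussianReal (μ i) 1) i
      have hm : MeasurableSet {t : ℝ | r ≤ |t - μ i|} :=
        measurableSet_le (by fun_prop) (by fun_prop)
      refine le_trans (le_of_eq ?_) (gaussianReal_abs_sub_ge_le (μ i) hr)
      rw [← hmp.measure_preimage hm.nullMeasurableSet]
      rfl
    refine (sum_le_sum fun i _ => hi i).trans_eq ?_
    rw [sum_const, card_univ, Fintype.card_fin, nsmul_eq_mul, ← ENNReal.ofReal_natCast,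
      ← ENNReal.ofReal_mul (by positivity)]
    congr 1
    ring
  have h1 := ENNReal.toReal_le_of_le_ofReal (by positivity) hle
  have h2 := probReal_compl_eq_one_sub (μ := gaussian μ) hms
  rw [Measure.real] at h2
  linarith

end GaussianTail

/-! ### Sparse polynomials as halfspaces in feature space -/

section SparsePolynomials

/-- A sum with at most `N` nonzero weights is a weighted sum over `N` chosen indices. -/
lemma exists_sum_eq_of_ncard_le {β : Type*} [Fintype β] [Nonempty β] {N : ℕ} (w : β → ℝ)
    (hw : {b | w b ≠ 0}.ncard ≤ N) :
    ∃ (f : Fin N → β) (a : Fin N → ℝ), ∀ u : β → ℝ, ∑ b, w b * u b = ∑ j, a j * u (f j) := by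
  classical
  obtain ⟨g⟩ : Nonempty ({b // w b ≠ 0} ↪ Fin N) := by
    refine Function.Embedding.nonempty_of_card_le ?_
    rw [Fintype.card_fin, ← Nat.card_eq_fintype_card]
    exact hw
  -- Slots outside the support are padded with weight `0` and an arbitrary index.
  refine ⟨Function.extend g Subtype.val fun _ => Classical.arbitrary β,
    Function.extend g (fun b => w b) 0, fun u => ?_⟩
  have h1 : ∑ b : {b // w b ≠ 0}, w b * u b = ∑ b, w b * u b :=
    Fintype.sum_of_injective Subtype.val Subtype.val_injective _ _
      (fun b hb => by
        have : w b = 0 := by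
          by_contra h
          exact hb ⟨⟨b, h⟩, rfl⟩
        simp [this]) fun _ => rfl
  rw [← h1]
  refine Fintype.sum_of_injective g g.injective _ _ (fun j hj => ?_) fun b => ?_
  · rw [Function.extend_apply' _ _ _ (by simpa using hj)]
    simp
  · rw [g.injective.extend_apply, g.injective.extend_apply]

/-- The degree-`2` harmonic polynomial with one nonzero coefficient, at position `q`. -/
noncomputable def harmonicMonomial {d : ℕ} (q : Fin d × Fin d) (x : Fin d → ℝ) : ℝ :=
  (Real.sqrt 2)⁻¹ * ∏ j, Polynomial.aeval (x j)
    (Polynomial.hermite ((if q.1 = j then 1 else 0) + (if q.2 = j then 1 else 0)))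

lemma measurable_harmonicMonomial {d : ℕ} (q : Fin d × Fin d) :
    Measurable (harmonicMonomial q) := by
  unfold harmonicMonomial
  refine Measurable.const_mul (Finset.measurable_prod _ fun j _ => ?_) _
  exact (Polynomial.continuous_aeval _).measurable.comp (measurable_pi_apply j)

/-- The feature maps whose linear combinations are the sparse polynomials. -/
noncomputable def sparseFeature {d k : ℕ} :
    (Fin (k ^ 2) → Fin d) ⊕ (Fin (k ^ 2) → Fin d × Fin d) → (Fin d → ℝ) → Fin (k ^ 2) → ℝ
  | .inl f, x => fun j => x (f j)
  | .inr f, x => fun j => harmonicMonomial (f j) x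

lemma measurable_sparseFeature {d k : ℕ}
    (f : (Fin (k ^ 2) → Fin d) ⊕ (Fin (k ^ 2) → Fin d × Fin d)) :
    Measurable (sparseFeature f) := by
  rcases f with f | f
  · exact measurable_pi_lambda _ fun j => measurable_pi_apply (f j)
  · exact measurable_pi_lambda _ fun j => measurable_harmonicMonomial (f j)

lemma IsSparsePoly.exists_feature {d k : ℕ} (hd : 1 ≤ d) {p : (Fin d → ℝ) → ℝ}
    (hp : IsSparsePoly k p) :
    ∃ (f : (Fin (k ^ 2) → Fin d) ⊕ (Fin (k ^ 2) → Fin d × Fin d)) (a : Fin (k ^ 2) → ℝ),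
      p = fun x => a ⬝ᵥ sparseFeature f x := by
  have : Nonempty (Fin d) := ⟨⟨0, hd⟩⟩
  rcases hp with ⟨v, hv, rfl⟩ | ⟨A, -, hA, rfl⟩
  · obtain ⟨f, a, hfa⟩ := exists_sum_eq_of_ncard_le v hv
    exact ⟨.inl f, a, funext fun x => hfa x⟩
  · obtain ⟨f, a, hfa⟩ := exists_sum_eq_of_ncard_le (fun q : Fin d × Fin d => A q.1 q.2) hA
    refine ⟨.inr f, a, funext fun x => ?_⟩
    refine Eq.trans ?_ (hfa fun q => harmonicMonomial q x)
    rw [harmonic, Fintype.sum_prod_type, mul_sum]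
    refine sum_congr rfl fun i _ => ?_
    rw [mul_sum]
    refine sum_congr rfl fun j _ => ?_
    simp only [harmonicMonomial]
    ring

/-- Independent Gaussian samples approximate, with high probability, the probabilities that sparse
polynomials are nonnegative and the mass of a given ball around the mean. -/
theorem measure_not_sample_accurate_le {d k : ℕ} (hd : 1 ≤ d) (hk : 1 ≤ k) {ι : Type*} [Fintype ι]
    (hm : 0 < Fintype.card ι) (μ : Fin d → ℝ) (r : ℝ) {τ ε η : ℝ} (hτ : 0 < τ) (hτ1 : τ < 1)
    (hε : 0 < ε) (hη : 0 < η)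
    (hεm : 20 * k ^ 4 + Real.log (48 * d ^ (2 * k ^ 2) / τ) ≤ Fintype.card ι * ε ^ 2 / 640)
    (hηm : 20 * k ^ 4 + Real.log (48 * d ^ (2 * k ^ 2) / τ) ≤ Fintype.card ι * η ^ 2 / 640) :
    Measure.pi (fun _ : ι => gaussian μ) {x | ¬ ((∀ p, IsSparsePoly k p →
        |(gaussian μ).real {y | 0 ≤ p y} - #{i | 0 ≤ p (x i)} / Fintype.card ι| ≤ ε) ∧
      |(gaussian μ).real {y | ‖y - μ‖ ≤ r} - #{i | ‖x i - μ‖ ≤ r} / Fintype.card ι| ≤ η)} ≤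
      ENNReal.ofReal τ := by
  have hd' : (1 : ℝ) ≤ d := by exact_mod_cast hd
  have hk' : (1 : ℝ) ≤ (k : ℝ) ^ 4 := one_le_pow₀ (by exact_mod_cast hk)
  -- At most `2 d ^ (2 k²)` feature maps and one ball give at most `3 d ^ (2 k²)` events, each of
  -- probability at most `4 δ`.
  set δ := τ / (12 * d ^ (2 * k ^ 2)) with hδdef
  have hdp : (1 : ℝ) ≤ (d : ℝ) ^ (2 * k ^ 2) := one_le_pow₀ hd'
  have hδ : 0 < δ := by positivity
  have hδ1 : δ ≤ 1 := by
    rw [hδdef, div_le_one (by positivity)]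
    linarith
  have h4δ : 4 / δ = 48 * d ^ (2 * k ^ 2) / τ := by
    rw [hδdef]
    field_simp
    ring
  rw [← h4δ] at hεm hηm
  set Q := Measure.pi (fun _ : ι => gaussian μ)
  let bad (f : (Fin (k ^ 2) → Fin d) ⊕ (Fin (k ^ 2) → Fin d × Fin d)) : Set (ι → Fin d → ℝ) :=
    {x | ∃ a : Fin (k ^ 2) → ℝ, ε < |(gaussian μ).real {z | 0 ≤ a ⬝ᵥ sparseFeature f z} -
        #{i | 0 ≤ a ⬝ᵥ sparseFeature f (x i)} / Fintype.card ι|}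
  -- The ball is a halfspace for the single feature `r - ‖z - μ‖`, with coefficient `1`.
  let far : Set (ι → Fin d → ℝ) :=
    {x | ∃ a : Fin 1 → ℝ, η < |(gaussian μ).real {z | 0 ≤ a ⬝ᵥ fun _ => r - ‖z - μ‖} -
        #{i | 0 ≤ a ⬝ᵥ fun _ => r - ‖x i - μ‖} / Fintype.card ι|}
  have hbad (f) : Q (bad f) ≤ ENNReal.ofReal (4 * δ) :=
    measure_exists_feature_deviation_le (Nat.one_le_pow _ _ hk) hm (gaussian μ)
      (measurable_sparseFeature f) hε hδ hδ1 (by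
        refine le_trans (le_of_eq ?_) hεm
        push_cast
        ring)
  have hfar : Q far ≤ ENNReal.ofReal (4 * δ) :=
    measure_exists_feature_deviation_le le_rfl hm (gaussian μ)
      (φ := fun z _ => r - ‖z - μ‖) (by fun_prop) hη hδ hδ1 (by
        refine le_trans ?_ hηm
        push_cast
        linarith)
  have hsub : {x : ι → Fin d → ℝ | ¬ ((∀ p, IsSparsePoly k p →
        |(gaussian μ).real {y | 0 ≤ p y} - #{i | 0 ≤ p (x i)} / Fintype.card ι| ≤ ε) ∧
      |(gaussian μ).real {y | ‖y - μ‖ ≤ r} - #{i | ‖x i - μ‖ ≤ r} / Fintype.card ι| ≤ η)} ⊆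
      (⋃ f, bad f) ∪ far := by
    intro x hx
    rcases not_and_or.1 hx with h | h
    · push Not at h
      obtain ⟨p, hp, hlt⟩ := h
      obtain ⟨f, a, rfl⟩ := hp.exists_feature hd
      exact Or.inl (Set.mem_iUnion.2 ⟨f, a, hlt⟩)
    · exact Or.inr ⟨fun _ => 1, by simpa [dotProduct] using h⟩
  have hcard : (Fintype.card ((Fin (k ^ 2) → Fin d) ⊕ (Fin (k ^ 2) → Fin d × Fin d)) : ℝ) ≤
      2 * d ^ (2 * k ^ 2) := by
    simp only [Fintype.card_sum, Fintype.card_fun, Fintype.card_fin, Fintype.card_prod]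
    push_cast
    have h1 : (d : ℝ) ^ k ^ 2 ≤ d ^ (2 * k ^ 2) := pow_le_pow_right₀ hd' (by omega)
    have h2 : ((d : ℝ) * d) ^ k ^ 2 = d ^ (2 * k ^ 2) := by rw [pow_mul, sq (d : ℝ)]
    linarith
  calc Q _ ≤ Q (⋃ f, bad f) + Q far := (measure_mono hsub).trans (measure_union_le _ _)
    _ ≤ ∑ f, Q (bad f) + Q far := by gcongr; exact measure_iUnion_fintype_le _ _
    _ ≤ ∑ _f : (Fin (k ^ 2) → Fin d) ⊕ (Fin (k ^ 2) → Fin d × Fin d), ENNReal.ofReal (4 * δ) +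
          ENNReal.ofReal (4 * δ) := add_le_add (sum_le_sum fun f _ => hbad f) hfar
    _ = ENNReal.ofReal ((Fintype.card ((Fin (k ^ 2) → Fin d) ⊕ (Fin (k ^ 2) → Fin d × Fin d)) + 1) *
          (4 * δ)) := by
        rw [sum_const, card_univ, nsmul_eq_mul, ← ENNReal.ofReal_natCast,
          ← ENNReal.ofReal_mul (by positivity), ← ENNReal.ofReal_add (by positivity) (by positivity)]
        congr 1
        ring
    _ ≤ ENNReal.ofReal τ := by
        refine ENNReal.ofReal_le_ofReal ?_
        calc _ ≤ (3 * (d : ℝ) ^ (2 * k ^ 2)) * (4 * δ) := by gcongr; linarith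
          _ = τ := by rw [hδdef]; field_simp; norm_num

end SparsePolynomials

end InitialList

namespace InitialList

/-! ### Deterministic analysis of the clustering -/

section Algorithm

/-- A greedy selection: elements satisfying `dense` that are `near` no earlier selected one. -/
lemma foldl_greedy {E : Type*} (dense : E → Prop) (near : E → E → Prop)
    [∀ (𝒞 : List E) x, Decidable (dense x ∧ ∀ x' ∈ 𝒞, ¬ near x x')] (hnear : ∀ x, near x x)
    (l init : List E) (hinit : ∀ x ∈ init, dense x)
    (hpair : init.Pairwise fun x' x => ¬ near x x') :
    let 𝒞 := l.foldl (fun 𝒞 x => if dense x ∧ ∀ x' ∈ 𝒞, ¬ near x x' then 𝒞 ++ [x] else 𝒞) init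
    init ⊆ 𝒞 ∧ (∀ x ∈ 𝒞, dense x) ∧ 𝒞.Pairwise (fun x' x => ¬ near x x') ∧
      ∀ x ∈ l, dense x → ∃ c ∈ 𝒞, near x c := by
  induction l generalizing init with
  | nil => exact ⟨List.Subset.refl _, hinit, hpair, by simp⟩
  | cons y l ih =>
    simp only [List.foldl_cons]
    by_cases h : dense y ∧ ∀ x' ∈ init, ¬ near y x'
    · rw [if_pos h]
      obtain ⟨h1, h2, h3, h4⟩ := ih (init ++ [y])
        (by
          intro x hx
          rcases List.mem_append.1 hx with hx | hx
          · exact hinit x hx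
          · rw [List.mem_singleton.1 hx]; exact h.1)
        (by
          rw [List.pairwise_append]
          refine ⟨hpair, by simp, fun x hx z hz => ?_⟩
          rw [List.mem_singleton.1 hz]
          exact h.2 x hx)
      refine ⟨fun x hx => h1 (List.mem_append_left _ hx), h2, h3, fun x hx hd => ?_⟩
      rcases List.mem_cons.1 hx with rfl | hx
      · exact ⟨x, h1 (by simp), hnear x⟩
      · exact h4 x hx hd
    · rw [if_neg h]
      obtain ⟨h1, h2, h3, h4⟩ := ih init hinit hpair
      refine ⟨h1, h2, h3, fun x hx hd => ?_⟩
      rcases List.mem_cons.1 hx with rfl | hx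
      · rw [not_and] at h
        have := h hd
        push Not at this
        obtain ⟨c, hc, hxc⟩ := this
        exact ⟨c, h1 hc, hxc⟩
      · exact h4 x hx hd

lemma sum_card_filter_le {E F : Type*} (p : F → E → Prop) [∀ c, DecidablePred (p c)] (cs : List F)
    (T : Multiset E) (h : cs.Pairwise fun c c' => ∀ y, ¬ (p c y ∧ p c' y)) :
    (cs.map fun c => (T.filter (p c)).card).sum ≤ T.card := by
  induction cs generalizing T with
  | nil => simp
  | cons c cs ih =>
    obtain ⟨h1, h2⟩ := List.pairwise_cons.1 h
    have key := ih (T.filter fun y => ¬ p c y) h2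
    have e : (cs.map fun c' => ((T.filter fun y => ¬ p c y).filter (p c')).card) =
        cs.map fun c' => (T.filter (p c')).card := by
      refine List.map_congr_left fun c' hc' => ?_
      rw [Multiset.filter_filter]
      congr 1
      refine Multiset.filter_congr fun y _ => ?_
      have := h1 c' hc' y
      tauto
    rw [e] at key
    have hT := congrArg Multiset.card (Multiset.filter_add_not (p c) T)
    rw [Multiset.card_add] at hT
    rw [List.map_cons, List.sum_cons]
    omega

open Classical in
lemma clusterCenters_spec {d : ℕ} {α r : ℝ} (hr : 0 ≤ r) (l : List (Fin d → ℝ)) :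
    (∀ x ∈ clusterCenters α r l,
      α * l.length ≤ (((l : Multiset (Fin d → ℝ)).filter fun y => ‖x - y‖ ≤ 2 * r).card : ℝ)) ∧
    (clusterCenters α r l).Pairwise (fun x' x => ¬ ‖x - x'‖ ≤ 4 * r) ∧
    ∀ x ∈ l,
      α * l.length ≤ (((l : Multiset (Fin d → ℝ)).filter fun y => ‖x - y‖ ≤ 2 * r).card : ℝ) →
      ∃ c ∈ clusterCenters α r l, ‖x - c‖ ≤ 4 * r :=
  (foldl_greedy (fun x => α * l.length ≤
      (((l : Multiset (Fin d → ℝ)).filter fun y => ‖x - y‖ ≤ 2 * r).card : ℝ))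
    (fun x x' => ‖x - x'‖ ≤ 4 * r) (fun x => by simpa using by linarith) l [] (by simp)
    (by simp)).2

/-- Centres more than `4r` apart have disjoint balls of radius `2r`, each holding a fraction `α` of
the data. -/
lemma length_clusterCenters_le {d : ℕ} {α r : ℝ} (hα : 0 < α) (hr : 0 ≤ r)
    {l : List (Fin d → ℝ)} (hl : 0 < l.length) :
    ((clusterCenters α r l).length : ℝ) ≤ 1 / α := by
  classical
  obtain ⟨h1, h2, -⟩ := clusterCenters_spec (α := α) hr l
  have hsum := sum_card_filter_le (fun c y : Fin d → ℝ => ‖c - y‖ ≤ 2 * r)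
    (clusterCenters α r l) (l : Multiset (Fin d → ℝ)) (h2.imp fun {x' x} hxx' y hy => hxx' (by
      calc ‖x - x'‖ = ‖(x - y) - (x' - y)‖ := by rw [sub_sub_sub_cancel_right]
        _ ≤ ‖x - y‖ + ‖x' - y‖ := norm_sub_le _ _
        _ ≤ 4 * r := by linarith [hy.1, hy.2]))
  have hlow : ((clusterCenters α r l).length : ℝ) * (α * l.length) ≤
      (((clusterCenters α r l).map fun c =>
        ((l : Multiset (Fin d → ℝ)).filter fun y => ‖c - y‖ ≤ 2 * r).card).sum : ℕ) := by
    generalize clusterCenters α r l = cs at h1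
    induction cs with
    | nil => simp
    | cons c cs ih =>
      rw [List.map_cons, List.sum_cons, List.length_cons]
      push_cast
      have a1 := ih fun x hx => h1 x (List.mem_cons_of_mem _ hx)
      have a2 := h1 c List.mem_cons_self
      push_cast at a1
      linarith
  have hl' : (0 : ℝ) < l.length := by exact_mod_cast hl
  have := hlow.trans (Nat.cast_le.2 hsum)
  rw [Multiset.coe_card] at this
  rw [le_div_iff₀ hα]
  nlinarith

open Classical in
/-- If most points of a large `S ≤ T` lie in a ball of radius `r`, one of the returned clusters
contains all of these points. -/
lemma exists_cluster_superset {d k : ℕ} {α τ C : ℝ} (hα0 : 0 < α) (hα : α ≤ 1 / 2) (hC : 0 ≤ C)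
    {μ : Fin d → ℝ} {l : List (Fin d → ℝ)} (hl : 0 < l.length) {S : Multiset (Fin d → ℝ)}
    (hSl : S ≤ (l : Multiset (Fin d → ℝ))) (hS : 2 * α * l.length ≤ S.card)
    (hball : (1 - α / 6) * S.card ≤
      ((S.filter fun y => ‖y - μ‖ ≤ C * Real.sqrt (gam d k α τ)).card : ℝ)) :
    ∃ T' ∈ cluster C k α τ l, max ((1 - α / 6) * S.card) (α * T'.card) ≤ ((S ∩ T').card : ℝ) ∧
      ∀ x ∈ T', ∀ y ∈ T', ‖x - y‖ ≤ 12 * (C * Real.sqrt (gam d k α τ)) := by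
  set r := C * Real.sqrt (gam d k α τ)
  have hr : 0 ≤ r := by positivity
  have hl' : (0 : ℝ) < l.length := by exact_mod_cast hl
  have hαl : 0 < α * l.length := by positivity
  -- Here `α ≤ 1 / 2` gives `(1 - α / 6) * 2 α ≥ α`.
  have hlow : α * l.length ≤ ((S.filter fun y => ‖y - μ‖ ≤ r).card : ℝ) := by nlinarith
  obtain ⟨x, hx⟩ : ∃ x, x ∈ S.filter fun y => ‖y - μ‖ ≤ r := by
    refine Multiset.exists_mem_of_ne_zero fun h => ?_
    rw [h] at hlow
    simp at hlow
    linarith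
  obtain ⟨hxS, hxr⟩ := Multiset.mem_filter.1 hx
  have hxl : x ∈ l := Multiset.mem_coe.1 (Multiset.mem_of_le hSl hxS)
  obtain ⟨-, -, hcov⟩ := clusterCenters_spec (α := α) hr l
  obtain ⟨c, hc, hxc⟩ := hcov x hxl (hlow.trans (by
    refine Nat.cast_le.2 (Multiset.card_le_card ?_)
    calc S.filter (fun y => ‖y - μ‖ ≤ r)
        = (S.filter fun y => ‖y - μ‖ ≤ r).filter fun y => ‖x - y‖ ≤ 2 * r :=
          (Multiset.filter_eq_self.2 fun y hy => by
            have := norm_sub_le_norm_sub_add_norm_sub x μ y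
            have := (Multiset.mem_filter.1 hy).2
            rw [norm_sub_rev] at this
            linarith).symm
      _ ≤ _ := Multiset.filter_le_filter _ ((Multiset.filter_le _ _).trans hSl)))
  -- The chosen centre is within `4r` of `x`, and `x` within `2r` of every point of `S` in the ball
  -- around `μ`.
  refine ⟨_, List.mem_map.2 ⟨c, hc, rfl⟩, ?_, fun y hy z hz => ?_⟩
  · have hsub : S.filter (fun y => ‖y - μ‖ ≤ r) ≤
        S ∩ (l : Multiset (Fin d → ℝ)).filter fun y => ‖c - y‖ ≤ 6 * r := by
      refine Multiset.le_inter (Multiset.filter_le _ _) ?_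
      calc S.filter (fun y => ‖y - μ‖ ≤ r)
          = (S.filter fun y => ‖y - μ‖ ≤ r).filter fun y => ‖c - y‖ ≤ 6 * r :=
            (Multiset.filter_eq_self.2 fun y hy => by
              have h1 := norm_sub_le_norm_sub_add_norm_sub c x y
              have h2 := norm_sub_le_norm_sub_add_norm_sub x μ y
              have := (Multiset.mem_filter.1 hy).2
              rw [norm_sub_rev] at this hxc
              linarith).symm
        _ ≤ _ := Multiset.filter_le_filter _ ((Multiset.filter_le _ _).trans hSl)
    have hcard := Nat.cast_le (α := ℝ).2 (Multiset.card_le_card hsub)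
    refine max_le (hball.trans hcard) (le_trans ?_ (hlow.trans hcard))
    have : (((l : Multiset (Fin d → ℝ)).filter fun y => ‖c - y‖ ≤ 6 * r).card : ℝ) ≤ l.length := by
      rw [← Multiset.coe_card]
      exact Nat.cast_le.2 (Multiset.card_le_card (Multiset.filter_le _ _))
    gcongr
  · have h1 := (Multiset.mem_filter.1 hy).2
    have h2 := (Multiset.mem_filter.1 hz).2
    have h3 := norm_sub_le_norm_sub_add_norm_sub y c z
    rw [norm_sub_rev] at h1
    linarith

end Algorithm

end InitialList

namespace InitialList

/-! ### Numerical constants -/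

section Constants

/-- The factor `α⁻¹ ^ 6 k ^ 8 γ ^ 4` is `ε⁻²` up to `100²`, and `3200000 = 640 * 100² / 2`. The term
`1 / c ^ 4` in `K` compensates for a small `γ` where no `γ ^ 4` is needed. The last bound serves the
diameter. -/
lemma sample_size_bounds {c K α L : ℝ} {k m γ : ℝ} (hc : 0 < c)
    (hK : K = 3200000 * (67 / c + 2) * (1 + 1 / c ^ 4)) (hα0 : 0 < α) (hα : α ≤ 1 / 2)
    (hk : 1 ≤ k) (hL : c ≤ L) (hγ : c ≤ γ)
    (hm : 2 * K * (α⁻¹ ^ 6 * k ^ 12 * L * γ ^ 4) ≤ m) :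
    k ^ 4 * L * (67 / c + 2) ≤ m * (α ^ 3 / (100 * k ^ 4 * γ ^ 2)) ^ 2 / 640 ∧
    k ^ 4 * L * (67 / c + 2) ≤ m * (α / 20) ^ 2 / 640 ∧ k * L ≤ m := by
  have hγ0 : 0 < γ := hc.trans_le hγ
  have hL0 : 0 < L := hc.trans_le hL
  set b := 67 / c + 2 with hb
  have hb2 : 2 ≤ b := by rw [hb]; linarith [show 0 < 67 / c by positivity]
  have hK1 : 3200000 * b ≤ K := by
    rw [hK]
    have : 0 < 1 / c ^ 4 := by positivity
    nlinarith
  have hK2 : 3200000 * b ≤ K * c ^ 4 := by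
    rw [hK]
    have e : 3200000 * b * (1 + 1 / c ^ 4) * c ^ 4 = 3200000 * b * (c ^ 4 + 1) := by
      field_simp
    rw [e]
    have : 0 < c ^ 4 := by positivity
    nlinarith
  have hK0 : 0 ≤ K := by linarith
  have hγc : c ^ 4 ≤ γ ^ 4 := by gcongr
  have hαi : 1 ≤ α⁻¹ := (one_le_inv₀ hα0).2 (by linarith)
  refine ⟨?_, ?_, ?_⟩
  · calc k ^ 4 * L * b ≤ k ^ 4 * L * (K / 3200000) := by gcongr; linarith
      _ = 2 * K * (α⁻¹ ^ 6 * k ^ 12 * L * γ ^ 4) * (α ^ 3 / (100 * k ^ 4 * γ ^ 2)) ^ 2 / 640 := by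
        field_simp
        ring
      _ ≤ _ := by gcongr
  · calc k ^ 4 * L * b ≤ k ^ 4 * L * (K * c ^ 4 / 3200000) := by gcongr; linarith
      _ ≤ k ^ 12 * L * (K * γ ^ 4 / 128000) := by gcongr <;> norm_num
      _ = 1 ^ 4 * (k ^ 12 * L * (K * γ ^ 4 / 128000)) := by ring
      _ ≤ α⁻¹ ^ 4 * (k ^ 12 * L * (K * γ ^ 4 / 128000)) := by gcongr
      _ = 2 * K * (α⁻¹ ^ 6 * k ^ 12 * L * γ ^ 4) * (α / 20) ^ 2 / 640 := by
        field_simp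
        ring
      _ ≤ _ := by gcongr
  · calc k * L = 1 * (1 ^ 6 * k ^ 1 * L) := by ring
      _ ≤ (2 * (K * c ^ 4)) * (α⁻¹ ^ 6 * k ^ 12 * L) := by
        gcongr
        · linarith
        · norm_num
      _ ≤ (2 * (K * γ ^ 4)) * (α⁻¹ ^ 6 * k ^ 12 * L) := by gcongr
      _ = 2 * K * (α⁻¹ ^ 6 * k ^ 12 * L * γ ^ 4) := by ring
      _ ≤ m := hm

/-- With `log 48 ≤ 47`, the constants merge into `67 k⁴`, absorbed through `log (d / τ) ≥ c`; the
summand `2` pays for the remaining logarithms. -/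
lemma log_union_bound_le {c τ : ℝ} {d k : ℕ} (hc : 0 < c) (hd : 1 ≤ d) (hk : 1 ≤ k) (hτ : 0 < τ)
    (hτ1 : τ < 1) (hL : c ≤ Real.log (1 / τ)) :
    20 * (k : ℝ) ^ 4 + Real.log (48 * d ^ (2 * k ^ 2) / τ) ≤
      k ^ 4 * Real.log (d / τ) * (67 / c + 2) := by
  have hd' : (1 : ℝ) ≤ d := by exact_mod_cast hd
  have hk' : (1 : ℝ) ≤ k := by exact_mod_cast hk
  have hl : Real.log (d / τ) = Real.log d + Real.log (1 / τ) := by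
    rw [← Real.log_mul (by positivity) (by positivity)]
    congr 1
    ring
  have hl0 : 0 ≤ Real.log d := Real.log_nonneg hd'
  have hlc : c ≤ Real.log (d / τ) := by linarith
  have h1 : Real.log (48 * d ^ (2 * k ^ 2) / τ) =
      Real.log 48 + 2 * k ^ 2 * Real.log d + Real.log (1 / τ) := by
    rw [div_eq_mul_one_div, Real.log_mul (by positivity) (by positivity),
      Real.log_mul (by positivity) (by positivity), Real.log_pow]
    push_cast
    ring
  have h48 := Real.log_le_sub_one_of_pos (show (0 : ℝ) < 48 by norm_num)
  have hk4 : (1 : ℝ) ≤ (k : ℝ) ^ 4 := one_le_pow₀ hk'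
  have hk24 : (k : ℝ) ^ 2 ≤ (k : ℝ) ^ 4 := pow_le_pow_right₀ hk' (by norm_num)
  have h67 : 67 * (k : ℝ) ^ 4 ≤ k ^ 4 * Real.log (d / τ) * (67 / c) := by
    have : 1 ≤ Real.log (d / τ) / c := by rwa [le_div_iff₀ hc, one_mul]
    calc 67 * (k : ℝ) ^ 4 ≤ 67 * k ^ 4 * (Real.log (d / τ) / c) :=
          le_mul_of_one_le_right (by positivity) this
      _ = _ := by ring
  have h2 : 2 * (k : ℝ) ^ 2 * Real.log d ≤ 2 * k ^ 4 * Real.log d := by gcongr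
  have h3 : Real.log (1 / τ) ≤ 2 * k ^ 4 * Real.log (1 / τ) :=
    le_mul_of_one_le_left (by linarith) (by linarith)
  rw [h1]
  have : (k : ℝ) ^ 4 * Real.log (d / τ) * 2 = 2 * k ^ 4 * Real.log d +
      2 * k ^ 4 * Real.log (1 / τ) := by rw [hl]; ring
  rw [mul_add]
  linarith

/-- The exponent is at least `γ + 40 / c`: `exp (-γ) ≤ α / (d c)` cancels the factor `d` of the
union bound, and `exp (-40 / c) ≤ c / 40` cancels `c`. -/
lemma gaussian_tail_bound_le {c C α τ : ℝ} {d k : ℕ} (hc : 0 < c) (hC : 2 + 80 / c ^ 2 ≤ C)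
    (hα0 : 0 < α) (hd : 1 ≤ d) (hk : 1 ≤ k) (hL : c ≤ Real.log (1 / τ)) (hγ : c ≤ gam d k α τ) :
    2 * d * Real.exp (-(C * Real.sqrt (gam d k α τ)) ^ 2 / 2) ≤ α / 20 := by
  have hd' : (1 : ℝ) ≤ d := by exact_mod_cast hd
  have hk' : (1 : ℝ) ≤ k := by exact_mod_cast hk
  have hL0 : 0 < Real.log (1 / τ) := hc.trans_le hL
  set γ := gam d k α τ with hγdef
  have hγ0 : 0 < γ := hc.trans_le hγ
  have hexp : Real.exp γ = d * k / α * Real.log (1 / τ) := by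
    rw [hγdef, gam, Real.exp_log (by positivity)]
  have ht : 0 < 80 / c ^ 2 := by positivity
  have hC2 : 1 + 40 / c ^ 2 ≤ C ^ 2 / 2 := by
    have : 40 / c ^ 2 = 80 / c ^ 2 / 2 := by ring
    rw [this]
    nlinarith
  have h1 : Real.exp (-(C * Real.sqrt γ) ^ 2 / 2) ≤ Real.exp (-γ) * Real.exp (-(40 / c)) := by
    rw [← Real.exp_add]
    refine Real.exp_le_exp.2 ?_
    rw [mul_pow, Real.sq_sqrt hγ0.le]
    have e1 : (1 + 40 / c ^ 2) * γ ≤ C ^ 2 / 2 * γ := by gcongr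
    have e2 : 40 / c ≤ 40 / c ^ 2 * γ := by
      calc 40 / c = 40 / c ^ 2 * c := by field_simp
        _ ≤ _ := by gcongr
    linarith
  have h2 : Real.exp (-γ) ≤ α / (d * c) := by
    rw [Real.exp_neg, hexp, inv_le_comm₀ (by positivity) (by positivity), inv_div]
    calc d * c / α = d * 1 / α * c := by ring
      _ ≤ d * k / α * Real.log (1 / τ) := by gcongr
  have h3 : Real.exp (-(40 / c)) ≤ c / 40 := by
    rw [Real.exp_neg, inv_le_comm₀ (by positivity) (by positivity), inv_div]
    linarith [Real.add_one_le_exp (40 / c)]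
  calc 2 * d * Real.exp (-(C * Real.sqrt γ) ^ 2 / 2) ≤ 2 * d * (α / (d * c) * (c / 40)) := by
        gcongr
        exact h1.trans (mul_le_mul h2 h3 (Real.exp_pos _).le (by positivity))
    _ = α / 20 := by
        field_simp
        norm_num

end Constants

/-! ### From the product measure to the data set -/

section Assembly

/-- The multiset of the samples with index in `I`. -/
def subsample {E : Type*} {n : ℕ} (I : Finset (Fin n)) (x : Fin n → E) : Multiset E :=
  (Finset.univ : Finset I).val.map fun i : I => x i

lemma card_subsample {E : Type*} {n : ℕ} (I : Finset (Fin n)) (x : Fin n → E) :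
    (subsample I x).card = I.card :=
  (Multiset.card_map _ _).trans (Fintype.card_coe I)

lemma card_filter_subsample {E : Type*} {n : ℕ} (I : Finset (Fin n)) (x : Fin n → E)
    (p : E → Prop) [DecidablePred p] :
    ((subsample I x).filter p).card = (Finset.univ.filter fun i : I => p (x i)).card := by
  rw [subsample, Multiset.filter_map, Multiset.card_map]
  rfl

lemma subsample_le {E : Type*} {n : ℕ} (I : Finset (Fin n)) (x : Fin n → E) :
    subsample I x ≤ Finset.univ.val.map x := by
  have : subsample I x = I.val.map x := Multiset.attach_map_val' I.val x
  rw [this]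
  exact Multiset.map_le_map (Finset.val_le_iff.2 (Finset.subset_univ I))

/-- Only the joint law of the Gaussian samples matters. The good event need not be measurable, so
the complement of a measurable hull of the bad one is taken. -/
lemma exists_measurableSet_sample {Ω E : Type*} [MeasurableSpace Ω] [MeasurableSpace E]
    {P : Measure Ω} [IsProbabilityMeasure P] {G : Measure E} [IsProbabilityMeasure G] {ι : Type*}
    [Fintype ι] {X : ι → Ω → E} (hX : ∀ i, HasLaw (X i) G P) (hindep : iIndepFun X P)
    {good : (ι → E) → Prop} {τ : ℝ} (hτ : 0 ≤ τ)
    (h : Measure.pi (fun _ : ι => G) {x | ¬ good x} ≤ ENNReal.ofReal τ) :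
    ∃ A : Set Ω, MeasurableSet A ∧ 1 - τ ≤ P.real A ∧ ∀ ω ∈ A, good fun i => X i ω := by
  have hmap : P.map (fun ω i => X i ω) = Measure.pi fun _ : ι => G := by
    rw [(iIndepFun_iff_map_fun_eq_pi_map fun i => (hX i).aemeasurable).1 hindep]
    simp_rw [(hX _).map_eq]
  rw [← hmap] at h
  have hle : P {ω | ¬ good fun i => X i ω} ≤ ENNReal.ofReal τ :=
    (Measure.le_map_apply (aemeasurable_pi_lambda _ fun i => (hX i).aemeasurable) _).trans h
  refine ⟨(toMeasurable P {ω | ¬ good fun i => X i ω})ᶜ, (measurableSet_toMeasurable _ _).compl,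
    ?_, fun ω hω => ?_⟩
  · rw [probReal_compl_eq_one_sub (measurableSet_toMeasurable _ _), Measure.real,
      measure_toMeasurable]
    linarith [ENNReal.toReal_le_of_le_ofReal hτ hle]
  · by_contra hcon
    exact hω (subset_toMeasurable _ _ hcon)

end Assembly

end InitialList

theorem mainTheorem5 :
    ∀ c : ℝ, 0 < c →
    ∃ C₀ : ℝ, 0 < C₀ ∧ ∃ K : ℝ, 0 < K ∧ ∀ C : ℝ, C₀ ≤ C → ∃ R : ℝ, 0 < R ∧
    ∀ (d k n : ℕ) (α τ : ℝ), 1 ≤ d → 1 ≤ k → 0 < α → α ≤ 1 / 2 → 0 < τ → τ < 1 →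
      c ≤ Real.log (1 / τ) → c ≤ InitialList.gam d k α τ →
      K * (α⁻¹ ^ 7 * k ^ 12 * Real.log (d / τ) * InitialList.gam d k α τ ^ 4) ≤ n →
    ∀ (μ : Fin d → ℝ)
      (Ω : Type*) (_ : MeasurableSpace Ω) (P : Measure Ω) (_ : IsProbabilityMeasure P)
      -- the samples; those with index in `I` are independent Gaussians, the others are arbitrary
      -- and may depend on them in any way
      (X : Fin n → Ω → Fin d → ℝ) (I : Finset (Fin n)),
      2 * α * n ≤ (I.card : ℝ) →
      (∀ i ∈ I, HasLaw (X i) (InitialList.gaussian μ) P) →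
      iIndepFun (fun i : I => X i) P →
      -- in whatever order `l` the algorithm goes through the data set
      (∀ ω, ∀ l : List (Fin d → ℝ), (l : Multiset (Fin d → ℝ)) = InitialList.dataset X ω →
        ((InitialList.cluster C k α τ l).length : ℝ) ≤ 1 / α ∧
        ∀ T' ∈ InitialList.cluster C k α τ l, T' ≤ InitialList.dataset X ω) ∧
      ∃ E : Set Ω, MeasurableSet E ∧ 1 - τ ≤ P.real E ∧
        ∀ ω ∈ E, ∀ l : List (Fin d → ℝ),
          (l : Multiset (Fin d → ℝ)) = InitialList.dataset X ω →
          ∃ T' ∈ InitialList.cluster C k α τ l, InitialList.IsGood R k α τ μ T' := by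
  open InitialList in
  classical
  intro c hc
  refine ⟨2 + 80 / c ^ 2, by positivity, 3200000 * (67 / c + 2) * (1 + 1 / c ^ 4), by positivity,
    fun C hC => ?_⟩
  have hC0 : 0 < C := lt_of_lt_of_le (by positivity) hC
  refine ⟨12 * C, by positivity, ?_⟩
  intro d k n α τ hd hk hα0 hα hτ hτ1 hL hγ hn μ Ω _ P _ X I hI hlaw hindep
  have hd' : (1 : ℝ) ≤ d := by exact_mod_cast hd
  have hk' : (1 : ℝ) ≤ k := by exact_mod_cast hk
  set γ := gam d k α τ
  have hγ0 : 0 < γ := hc.trans_le hγ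
  have hLd : Real.log (1 / τ) ≤ Real.log (d / τ) :=
    Real.log_le_log (by positivity) (by gcongr)
  have hLd0 : 0 < Real.log (d / τ) := by linarith
  set K := 3200000 * (67 / c + 2) * (1 + 1 / c ^ 4) with hK
  have hK0 : 0 < K := by positivity
  have hn0 : (0 : ℝ) < n := lt_of_lt_of_le (by positivity) hn
  -- The bound `#I ≥ 2 α n` costs one power of `α⁻¹`.
  have hIK : 2 * K * (α⁻¹ ^ 6 * k ^ 12 * Real.log (d / τ) * γ ^ 4) ≤ I.card := by
    refine le_trans (le_of_eq ?_) ((mul_le_mul_of_nonneg_left hn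
      (show 0 ≤ 2 * α by positivity)).trans hI)
    field_simp
  have hI0 : (0 : ℝ) < I.card := lt_of_lt_of_le (by positivity) hI
  obtain ⟨hε, hη, hkL⟩ := sample_size_bounds hc hK hα0 hα hk' (hL.trans hLd) hγ hIK
  have hlog := log_union_bound_le hc hd hk hτ hτ1 hL
  have hlen (ω : Ω) (l : List (Fin d → ℝ)) (hl : (l : Multiset (Fin d → ℝ)) = dataset X ω) :
      l.length = n := by
    have := congrArg Multiset.card hl
    simpa [dataset] using this
  have hn0' : 0 < n := by exact_mod_cast hn0
  refine ⟨fun ω l hl => ⟨?_, fun T' hT' => ?_⟩, ?_⟩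
  · rw [cluster, List.length_map]
    exact length_clusterCenters_le hα0 (by positivity) (by rw [hlen ω l hl]; exact hn0')
  · obtain ⟨x, -, rfl⟩ := List.mem_map.1 hT'
    rw [← hl]
    exact Multiset.filter_le _ _
  set r := C * Real.sqrt γ with hr
  obtain ⟨A, hA, hAτ, hgood⟩ := exists_measurableSet_sample (fun i : I => hlaw i i.2) hindep hτ.le
    (measure_not_sample_accurate_le (ι := I) hd hk (by simpa using hI0) μ r
      (ε := α ^ 3 / (100 * k ^ 4 * γ ^ 2)) (η := α / 20) hτ hτ1
      (by positivity) (by positivity) (hlog.trans (by simpa using hε))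
      (hlog.trans (by simpa using hη)))
  refine ⟨A, hA, hAτ, fun ω hω l hl => ?_⟩
  obtain ⟨hrep, hfar⟩ := hgood ω hω
  rw [Fintype.card_coe] at hfar
  simp only [Fintype.card_coe] at hrep
  set S := subsample I fun i => X i ω with hS
  have hScard : S.card = I.card := card_subsample _ _
  -- Gaussian tail and sampling error are at most `α / 20` each, and `α / 10 ≤ α / 6`.
  have hball : (1 - α / 6) * S.card ≤ ((S.filter fun y => ‖y - μ‖ ≤ r).card : ℝ) := by
    rw [card_filter_subsample, hScard, ← le_div_iff₀ hI0]
    have h1 := gaussian_norm_sub_le μ (show 0 ≤ r by positivity)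
    have h2 := gaussian_tail_bound_le (d := d) (k := k) hc hC hα0 hd hk hL hγ
    have h3 := (abs_le.1 hfar).2
    linarith
  obtain ⟨T', hT', hcard, hdiam⟩ := exists_cluster_superset (k := k) (τ := τ) hα0 hα hC0.le
    (l := l) (by rw [hlen ω l hl]; exact hn0')
    (by rw [hl]; exact subsample_le I fun i => X i ω)
    (by rw [hlen ω l hl, hScard]; exact hI) hball
  refine ⟨T', hT', S, ⟨?_, fun p hp => ?_⟩, hcard, fun x hx y hy => ?_⟩
  · rw [← Multiset.card_pos, hScard]
    exact_mod_cast hI0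
  · rw [empProb, card_filter_subsample, hScard]
    exact hrep p hp
  -- The diameter is at most `12 C √γ`, whence `R = 12 C`; and `γ ≤ log (d |S| / α)` because `k log
  -- (1 / τ) ≤ k log (d / τ) ≤ |S|`.
  · refine (hdiam x hx y hy).trans ?_
    rw [← mul_assoc]
    refine mul_le_mul_of_nonneg_left (Real.sqrt_le_sqrt ?_) (by positivity)
    have hL0 : 0 < Real.log (1 / τ) := hc.trans_le hL
    rw [gam, hScard]
    refine Real.log_le_log (by positivity) ?_
    calc d * k / α * Real.log (1 / τ) = d * (k * Real.log (1 / τ)) / α := by ring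
      _ ≤ d * I.card / α := by
        gcongr
        exact le_trans (by gcongr) hkL
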